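/- Let $(M,g)$ be an oriented smooth 4-dimensional spacetime of signature $(-+++)$, with Levi-Civita connection $\nabla$, Hodge dual $*$ and codifferential $\delta=*d*$ on 2-forms. Let $U$ be a smooth canonical unitary 2-form on $M$: at each point, $U$ is the metric area form $e_0^\flat\wedge e_1^\flat$ of a time-like plane $V$ ($g(e_0,e_0)=-1$, $g(e_1,e_1)=1$, $g(e_0,e_1)=0$). Together with its space-like orthogonal complement $H=V^\perp$, the plane $V$ forms the 2+2 almost-product structure associated with $U$. The structure is called umbilical if both plane fields $D\in\{V,H\}$ are, that is, if the symmetric part $(X,Y)\mapsto\frac12(\nabla_XY+\nabla_YX)^\perp$ ($X,Y$ tangent to $D$, ${}^\perp$ the projection onto $D^\perp$) of the second fundamental form of $D$ is of the form $g(X,Y)\,n$ for some vector $n$ at each point. Let $\phi,\psi$ be smooth real functions on $M$, and put $$A=e^{\phi}(\cos\psi\,U+\sin\psi\,{*U}),\qquad F=e^{-2\phi}(\cos 2\psi\,U-\sin 2\psi\,{*U}).$$ Then $A$ is a Killing-Yano tensor, that is, $\nabla_{(\alpha}A_{\beta)\mu}=0$, if and only if $F$ is an umbilical source-free Maxwell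 field, that is, $\delta F=0$, $\delta{*F}=0$ and the 2+2 structure associated with $U$ (which is the canonical 2-form of $F$) is umbilical, and moreover $$\cos\psi\,\delta U+\sin\psi\,\delta{*U}=0 .$$ -/

import Mathlib

open scoped Manifold ContDiff

noncomputable section

namespace Spacetime

/-- The model vector space `ℝ⁴`. -/
abbrev E4 : Type := EuclideanSpace ℝ (Fin 4)

/-! ## Linear algebra of a metric and a volume form on `ℝ⁴` -/

/-- The standard basis vectors of `ℝ⁴`. -/
def e (i : Fin 4) : E4 := EuclideanSpace.single i (1 : ℝ)

/-- The matrix `g_{ij}` of a bilinear form in the standard basis. -/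
def gram (g : E4 →L[ℝ] E4 →L[ℝ] ℝ) : Matrix (Fin 4) (Fin 4) ℝ :=
  Matrix.of fun i j => g (e i) (e j)

/-- The reciprocal basis `eⁱ = g^{ij} e_j`; for nondegenerate symmetric `g` it is determined by
`g(eⁱ, e_j) = δ_{ij}`. -/
def recip (g : E4 →L[ℝ] E4 →L[ℝ] ℝ) (i : Fin 4) : E4 := ∑ j, (gram g)⁻¹ i j • e j

/-- The Hodge dual of a 2-form, `(*α)_{μν} = ½ α^{ρσ} η_{ρσμν}`. -/
def hodge2 (g : E4 →L[ℝ] E4 →L[ℝ] ℝ) (η : E4 [⋀^Fin 4]→L[ℝ] ℝ) (α : E4 [⋀^Fin 2]→L[ℝ] ℝ) :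
    E4 [⋀^Fin 2]→L[ℝ] ℝ :=
  (1 / 2 : ℝ) • ∑ i, ∑ j, α ![recip g i, recip g j] • (η.curryLeft (e i)).curryLeft (e j)

/-- The Hodge dual of a 3-form, `(*α)_μ = (1/3!) α^{ρστ} η_{ρστμ}`. -/
def hodge3 (g : E4 →L[ℝ] E4 →L[ℝ] ℝ) (η : E4 [⋀^Fin 4]→L[ℝ] ℝ) (α : E4 [⋀^Fin 3]→L[ℝ] ℝ) :
    E4 [⋀^Fin 1]→L[ℝ] ℝ :=
  (1 / 6 : ℝ) • ∑ i, ∑ j, ∑ k, α ![recip g i, recip g j, recip g k] •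
    ((η.curryLeft (e i)).curryLeft (e j)).curryLeft (e k)

/-! ## Tensor fields on a 4-manifold and their expressions in the charts -/

section Fields

variable (M : Type*) [TopologicalSpace M] [ChartedSpace E4 M]

/-- (Not necessarily smooth) fields of alternating `k`-forms on `M`. -/
abbrev FormField (k : ℕ) := ∀ p : M, TangentSpace (𝓡 4) p [⋀^Fin k]→L[ℝ] ℝ

/-- (Not necessarily smooth) fields of bilinear forms on `M`. -/
abbrev BilinField := ∀ p : M, TangentSpace (𝓡 4) p →L[ℝ] TangentSpace (𝓡 4) p →L[ℝ] ℝ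

/-- (Not necessarily smooth) vector fields on `M`. -/
abbrev VecField := ∀ p : M, TangentSpace (𝓡 4) p

variable {M}

/-- The differential at `y` of the inverse of the chart at `p`. At `y = extChartAt (𝓡 4) p p` it is
the identity of `TangentSpace (𝓡 4) p = E4`. -/
def invChartDeriv (p : M) (y : E4) :
    E4 →L[ℝ] TangentSpace (𝓡 4) ((extChartAt (𝓡 4) p).symm y) :=
  mfderiv 𝓘(ℝ, E4) (𝓡 4) (extChartAt (𝓡 4) p).symm y

/-- The expression of a form in the chart at `p` (pull-back by the inverse chart). -/
def FormField.inChart {k : ℕ} (α : FormField M k) (p : M) (y : E4) : E4 [⋀^Fin k]→L[ℝ] ℝ :=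
  (α ((extChartAt (𝓡 4) p).symm y)).compContinuousLinearMap (invChartDeriv p y)

/-- The expression of a field of bilinear forms in the chart at `p`. -/
def BilinField.inChart (b : BilinField M) (p : M) (y : E4) : E4 →L[ℝ] E4 →L[ℝ] ℝ :=
  ContinuousLinearMap.bilinearComp (E := E4) (F := E4) (b ((extChartAt (𝓡 4) p).symm y))
    (invChartDeriv p y) (invChartDeriv p y)

/-- The expression of a vector field in the chart at `p` (push-forward by the chart). -/
def VecField.inChart (X : VecField M) (p : M) (y : E4) : E4 :=
  mfderiv (𝓡 4) 𝓘(ℝ, E4) (extChartAt (𝓡 4) p) ((extChartAt (𝓡 4) p).symm y)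
    (X ((extChartAt (𝓡 4) p).symm y))

/-- A form is smooth if its chart expressions are. -/
def FormField.IsSmooth {k : ℕ} (α : FormField M k) : Prop :=
  ∀ p : M, ContDiffOn ℝ ∞ (FormField.inChart α p) (extChartAt (𝓡 4) p).target

/-- A field of bilinear forms is smooth if its chart expressions are. -/
def BilinField.IsSmooth (b : BilinField M) : Prop :=
  ∀ p : M, ContDiffOn ℝ ∞ (BilinField.inChart b p) (extChartAt (𝓡 4) p).target

/-- Smoothness of a vector field at a point. -/
def VecField.IsSmoothAt (X : VecField M) (p : M) : Prop :=
  ContDiffAt ℝ ∞ (VecField.inChart X p) (extChartAt (𝓡 4) p p)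

/-- The exterior derivative of a form, computed at each point in the chart at that point. -/
def FormField.d {k : ℕ} (α : FormField M k) : FormField M (k + 1) := fun p =>
  (extDeriv (FormField.inChart α p) (extChartAt (𝓡 4) p p) : E4 [⋀^Fin (k + 1)]→L[ℝ] ℝ)

end Fields

/-! ## Oriented spacetimes -/

/-- An oriented spacetime: a smooth metric of signature `(-+++)` on the 4-manifold `M`, with an
orientation, given by its smooth metric volume form `vol`, which is one of the two (local) square
roots of `-det g`. -/
structure OrientedSpacetime (M : Type*) [TopologicalSpace M] [ChartedSpace E4 M] where
  metric : BilinField M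
  symm : ∀ p u v, metric p u v = metric p v u
  signature : ∀ p, ∃ b : Module.Basis (Fin 4) ℝ (TangentSpace (𝓡 4) p),
    ∀ i j, metric p (b i) (b j) = if i = j then (if i = 0 then -1 else 1) else 0
  smooth_metric : BilinField.IsSmooth metric
  vol : FormField M 4
  vol_sq : ∀ p v, (vol p v) ^ 2 = -(Matrix.of fun i j => metric p (v i) (v j)).det
  smooth_vol : FormField.IsSmooth vol

namespace OrientedSpacetime

variable {M : Type*} [TopologicalSpace M] [ChartedSpace E4 M] (S : OrientedSpacetime M)

/-- The Hodge dual `*α` of a 2-form. -/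
def star (α : FormField M 2) : FormField M 2 := fun p =>
  hodge2 (S.metric p) (S.vol p) (α p)

/-- The codifferential `δ = *d*` on 2-forms. -/
def codiff (α : FormField M 2) : FormField M 1 := fun p =>
  hodge3 (S.metric p) (S.vol p) (FormField.d (S.star α) p)

/-- The derivative `∂_u g(v, w)` of the metric components in the chart at `p`, at `p`. -/
def metricDeriv (p : M) (u v w : E4) : ℝ :=
  fderiv ℝ (BilinField.inChart S.metric p) (extChartAt (𝓡 4) p p) u v w

/-- The Christoffel symbols `Γ(u, v)` at `p` of the Levi-Civita connection in the chart at `p`: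
`g(Γ(u, v), w) = ½ (∂_u g(v, w) + ∂_v g(u, w) - ∂_w g(u, v))`. -/
def christoffel (p : M) (u v : E4) : E4 :=
  ∑ i, ((1 / 2 : ℝ) * (S.metricDeriv p u v (e i) + S.metricDeriv p v u (e i)
    - S.metricDeriv p (e i) u v)) • recip (S.metric p) i

/-- The Levi-Civita covariant derivative `∇_u Y` of a vector field at `p`. -/
def covDerivVec (Y : VecField M) (p : M) (u : TangentSpace (𝓡 4) p) : TangentSpace (𝓡 4) p :=
  (fderiv ℝ (VecField.inChart Y p) (extChartAt (𝓡 4) p p) u + S.christoffel p u (Y p) : E4)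

/-- The Levi-Civita covariant derivative `(∇_u α)(v, w)` of a 2-form at `p`. -/
def covDeriv (α : FormField M 2) (p : M) (u v w : TangentSpace (𝓡 4) p) : ℝ :=
  (fderiv ℝ (FormField.inChart α p) (extChartAt (𝓡 4) p p) u : E4 [⋀^Fin 2]→L[ℝ] ℝ) ![v, w]
    - α p ![S.christoffel p u v, w] - α p ![v, S.christoffel p u w]

/-- The Killing-Yano equation `∇_{(α} A_{β)μ} = 0` for a 2-form. -/
def IsKillingYano (A : FormField M 2) : Prop :=
  ∀ p u v w, S.covDeriv A p u v w + S.covDeriv A p v u w = 0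

/-- The source-free Maxwell equations `δF = 0`, `δ*F = 0`. -/
def IsMaxwell (F : FormField M 2) : Prop :=
  (∀ p, S.codiff F p = 0) ∧ ∀ p, S.codiff (S.star F) p = 0

/-- `U` is the canonical unitary 2-form of a 2+2 almost-product structure: it is smooth and, at each
point, the metric area form `e₀♭ ∧ e₁♭` of a time-like 2-plane with orthonormal basis `e₀, e₁`. -/
def IsCanonicalForm (U : FormField M 2) : Prop :=
  FormField.IsSmooth U ∧ ∀ p, ∃ e₀ e₁ : TangentSpace (𝓡 4) p,
    S.metric p e₀ e₀ = -1 ∧ S.metric p e₁ e₁ = 1 ∧ S.metric p e₀ e₁ = 0 ∧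
    ∀ v w, U p ![v, w] = S.metric p e₀ v * S.metric p e₁ w - S.metric p e₀ w * S.metric p e₁ v

/-- The space-like plane `H` of the structure with canonical form `U`: the kernel of `U`. -/
def spacePlane (U : FormField M 2) (p : M) : Set (TangentSpace (𝓡 4) p) :=
  {v | ∀ w, U p ![v, w] = 0}

/-- The orthogonal complement of a set of tangent vectors. -/
def orthogonal (p : M) (D : Set (TangentSpace (𝓡 4) p)) : Set (TangentSpace (𝓡 4) p) :=
  {v | ∀ w ∈ D, S.metric p v w = 0}

/-- The time-like plane `V = H^⊥` of the structure with canonical form `U`. -/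
def timePlane (U : FormField M 2) (p : M) : Set (TangentSpace (𝓡 4) p) :=
  S.orthogonal p (spacePlane U p)

/-- A field of planes `D` is umbilical if the symmetric part of its second fundamental form,
`(X, Y) ↦ ½ (∇_X Y + ∇_Y X)^⊥` for `X, Y` tangent to `D`, is proportional to the metric of `D`,
that is, equal to `g(X, Y) n^⊥` for some vector `n` at each point. -/
def IsUmbilicalPlaneField (D : ∀ p : M, Set (TangentSpace (𝓡 4) p)) : Prop :=
  ∀ p, ∃ n : TangentSpace (𝓡 4) p, ∀ X Y : VecField M,
    VecField.IsSmoothAt X p → VecField.IsSmoothAt Y p → (∀ q, X q ∈ D q) → (∀ q, Y q ∈ D q) →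
    ∀ z ∈ S.orthogonal p (D p),
      (1 / 2 : ℝ) * S.metric p (S.covDerivVec Y p (X p) + S.covDerivVec X p (Y p)) z
        = S.metric p (X p) (Y p) * S.metric p n z

/-- The 2+2 structure with canonical form `U` is umbilical if both of its planes are. -/
def IsUmbilicalStructure (U : FormField M 2) : Prop :=
  S.IsUmbilicalPlaneField (S.timePlane U) ∧ S.IsUmbilicalPlaneField (spacePlane U)

end OrientedSpacetime

end Spacetime

end

/-! At a point, choose an oriented orthonormal frame `b` with U = b₀♭∧b₁♭ and *U = b₂♭∧b₃♭. Since
U∧U = 0 and the norm of U is constant, ∇U has only the components 02, 03, 12, 13; since * is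
parallel, the same sixteen numbers give ∇*U (`cov_unitary_23`, `cov_unitary_01`, `cov_star`,
`cov_comb`). Every condition becomes a linear system in these numbers, with dφ and dψ: 20 equations
for Killing-Yano, against 8 + 8 + 4 for Maxwell, umbilicity and the extra condition.

The angle is removed by passing to the components of cos ψ ∇U + sin ψ ∇*U, with x = cos ψ dφ - sin ψ
dψ and y = sin ψ dφ + cos ψ dψ. The rotation mixes the umbilicity equations in pairs, so they keep
their form (`umbilical_rotate`). The two Maxwell equations mix by the angle 3ψ: 2ψ from F and ψ from
the new components (`closed_pair`). What remains is the case of angle zero (`killing_iff_rotated`),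
which is elementary. Total antisymmetry of ∇A makes both ∇₀A₁₂ and -∇₁A₀₂ equal to ∇₂A₀₁, so
exterior derivatives produce twice a derivative of the coefficients; this is the origin of the
exponent -2 and of the angle 2ψ in F. Comparison of the extra condition with Maxwell kills the other
derivatives of the coefficients.

Umbilicity is read from ∇U because V = ker *U and H = ker U: for X tangent to ker β, (∇_u β)(X, w) =
-β(∇_u X, w) (`cov_of_kernel`, `isUmbilicalAt_iff`).

Covariant identities come from differentiating pointwise algebraic ones along y₀ + tu after pulling
back by id - tΓ(u): the pulled-back metric is constant to first order and a pulled-back form has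
derivative ∇_u α (`hasDerivAt_metricT`, `hasDerivAt_formT_apply`). Everything is done at one point
in its own chart; naturality of * (`hodge2_comp`) and extension of local tangent fields
(`exists_extension`) link this to the manifold. -/

noncomputable section
namespace Spacetime

/-! ## Orthonormal frames -/

/-- Bilinear forms on `ℝ⁴`. -/
abbrev Bilin4 : Type := E4 →L[ℝ] E4 →L[ℝ] ℝ

/-! ### Multilinear expansion of alternating forms. -/

section Alternating

variable {n : ℕ} (f : E4 [⋀^Fin (n + 1)]→L[ℝ] ℝ)

lemma alt_cons_add (x y : E4) (v : Fin n → E4) :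
    f (Matrix.vecCons (x + y) v) = f (Matrix.vecCons x v) + f (Matrix.vecCons y v) :=
  congrArg (fun h => h v) (map_add f.curryLeft x y)

lemma alt_cons_smul (c : ℝ) (x : E4) (v : Fin n → E4) :
    f (Matrix.vecCons (c • x) v) = c * f (Matrix.vecCons x v) :=
  congrArg (fun h => h v) (map_smul f.curryLeft c x)

lemma alt_cons_sum {ι : Type*} (s : Finset ι) (x : ι → E4) (v : Fin n → E4) :
    f (Matrix.vecCons (∑ i ∈ s, x i) v) = ∑ i ∈ s, f (Matrix.vecCons (x i) v) := by
  refine (congrArg (fun h => h v) (map_sum f.curryLeft x s)).trans ?_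
  rw [ContinuousAlternatingMap.sum_apply]
  rfl

variable (f : E4 [⋀^Fin (n + 2)]→L[ℝ] ℝ)

lemma alt_cons_cons_add (a x y : E4) (v : Fin n → E4) :
    f (Matrix.vecCons a (Matrix.vecCons (x + y) v)) =
      f (Matrix.vecCons a (Matrix.vecCons x v)) + f (Matrix.vecCons a (Matrix.vecCons y v)) :=
  alt_cons_add (f.curryLeft a) x y v

lemma alt_cons_cons_smul (a : E4) (c : ℝ) (x : E4) (v : Fin n → E4) :
    f (Matrix.vecCons a (Matrix.vecCons (c • x) v)) =
      c * f (Matrix.vecCons a (Matrix.vecCons x v)) :=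
  alt_cons_smul (f.curryLeft a) c x v

lemma alt_cons_cons_sum {ι : Type*} (s : Finset ι) (a : E4) (x : ι → E4) (v : Fin n → E4) :
    f (Matrix.vecCons a (Matrix.vecCons (∑ i ∈ s, x i) v)) =
      ∑ i ∈ s, f (Matrix.vecCons a (Matrix.vecCons (x i) v)) :=
  alt_cons_sum (f.curryLeft a) s x v

lemma alt_swap (a b : E4) (v : Fin n → E4) :
    f (Matrix.vecCons a (Matrix.vecCons b v)) = -f (Matrix.vecCons b (Matrix.vecCons a v)) := by
  have h : ∀ x, f (Matrix.vecCons x (Matrix.vecCons x v)) = 0 := fun x =>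
    f.map_eq_zero_of_eq _ (i := 0) (j := 1) (by simp) (by simp)
  have := h (a + b)
  rw [alt_cons_add, alt_cons_cons_add, alt_cons_cons_add, h, h] at this
  linarith

end Alternating

/-- The diagonal entries of the Minkowski metric. -/
def sgn (i : Fin 4) : ℝ := if i = 0 then -1 else 1

lemma sgn_zero : sgn 0 = -1 := by simp [sgn]
lemma sgn_one : sgn 1 = 1 := by simp [sgn]
lemma sgn_two : sgn 2 = 1 := by simp [sgn]
lemma sgn_three : sgn 3 = 1 := by simp [sgn]
lemma sgn_mul_self (i : Fin 4) : sgn i * sgn i = 1 := by unfold sgn; split <;> norm_num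

/-- Orthonormal frames of a metric of signature `(-+++)`. -/
def IsFrame (g : Bilin4) (b : Fin 4 → E4) : Prop :=
  ∀ i j, g (b i) (b j) = if i = j then sgn i else 0

lemma sum_smul_e (x : E4) : x = ∑ i, x i • e i := by
  ext j
  simp [e, Pi.single_apply]

namespace IsFrame

variable {g : Bilin4} {b : Fin 4 → E4}

lemma metric_sum (hb : IsFrame g b) (c : Fin 4 → ℝ) (i : Fin 4) :
    g (b i) (∑ a, c a • b a) = sgn i * c i := by
  simp [map_sum, hb i, mul_comm]

lemma linearIndependent (hb : IsFrame g b) : LinearIndependent ℝ b := by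
  rw [Fintype.linearIndependent_iff]
  intro c hc i
  have h := hb.metric_sum c i
  rw [hc, map_zero] at h
  have h2 := congrArg (fun t => sgn i * t) h
  simp only [mul_zero, ← mul_assoc, sgn_mul_self, one_mul] at h2
  exact h2.symm

/-- A frame as a basis. -/
def basis (hb : IsFrame g b) : Module.Basis (Fin 4) ℝ E4 :=
  basisOfLinearIndependentOfCardEqFinrank hb.linearIndependent (by simp)

lemma basis_apply (hb : IsFrame g b) (i : Fin 4) : hb.basis i = b i := by
  simp [basis]

lemma expand (hb : IsFrame g b) (x : E4) : x = ∑ a, (sgn a * g (b a) x) • b a := by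
  have h := hb.basis.sum_repr x
  simp only [basis_apply] at h
  have h2 : ∀ i, sgn i * g (b i) x = hb.basis.repr x i := fun i => by
    conv_lhs => rw [← h, hb.metric_sum, ← mul_assoc, sgn_mul_self, one_mul]
  simp only [h2, h]

lemma metric_eq (hb : IsFrame g b) (hs : ∀ u v, g u v = g v u) (x y : E4) :
    g x y = ∑ a, sgn a * g (b a) x * g (b a) y := by
  conv_lhs => rw [hb.expand y]
  simp only [map_sum, map_smul, smul_eq_mul]
  exact Finset.sum_congr rfl fun a _ => by rw [hs x (b a)]; ring

lemma det_gram_ne_zero (hb : IsFrame g b) (hs : ∀ u v, g u v = g v u) : (gram g).det ≠ 0 := by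
  intro h
  -- A null vector of the Gram matrix would be orthogonal to everything, hence zero by expansion in
  -- the frame.
  obtain ⟨v, hv, hv0⟩ := Matrix.exists_mulVec_eq_zero_iff.mpr h
  have h1 : ∀ i, g (e i) (∑ j, v j • e j) = 0 := fun i => by
    have := congrFun hv0 i
    simpa [Matrix.mulVec, dotProduct, gram, map_sum, mul_comm] using this
  have h2 : ∀ x, g x (∑ j, v j • e j) = 0 := fun x => by
    generalize ∑ j, v j • e j = y at h1
    rw [hs, sum_smul_e x]
    simp [map_sum, hs y, h1]
  have h3 : ∑ j, v j • e j = 0 := by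
    rw [hb.expand (∑ j, v j • e j)]; simp [h2]
  apply hv
  funext k
  have := congrArg (fun x : E4 => x k) h3
  simpa [e, Pi.single_apply] using this

lemma metric_recip_e (hb : IsFrame g b) (hs : ∀ u v, g u v = g v u) (i j : Fin 4) :
    g (recip g i) (e j) = if i = j then 1 else 0 := by
  have h := Matrix.nonsing_inv_mul (gram g) (isUnit_iff_ne_zero.mpr (hb.det_gram_ne_zero hs))
  have := congrFun (congrFun h i) j
  rw [Matrix.mul_apply, Matrix.one_apply] at this
  rw [← this]
  simp [recip, gram, map_sum]

lemma metric_recip (hb : IsFrame g b) (hs : ∀ u v, g u v = g v u) (i : Fin 4) (x : E4) :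
    g (recip g i) x = x i := by
  conv_lhs => rw [sum_smul_e x]
  simp [map_sum, hb.metric_recip_e hs]

lemma recip_eq (hb : IsFrame g b) (hs : ∀ u v, g u v = g v u) (i : Fin 4) :
    recip g i = ∑ a, (sgn a * b a i) • b a := by
  rw [hb.expand (recip g i)]
  exact Finset.sum_congr rfl fun a _ => by rw [hs, hb.metric_recip hs]

/-- Contraction with the inverse metric does not depend on the basis. This replaces the coordinate
contractions of the definitions by signed sums over an orthonormal frame. -/
lemma sum_recip (hb : IsFrame g b) (hs : ∀ u v, g u v = g v u) (f : E4 → E4 → ℝ)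
    (hf₁ : ∀ (c : Fin 4 → ℝ) (x : Fin 4 → E4) y, f (∑ a, c a • x a) y = ∑ a, c a * f (x a) y)
    (hf₂ : ∀ x (c : Fin 4 → ℝ) (y : Fin 4 → E4), f x (∑ a, c a • y a) = ∑ a, c a * f x (y a)) :
    ∑ i, f (recip g i) (e i) = ∑ a, sgn a * f (b a) (b a) := by
  simp only [hb.recip_eq hs, hf₁]
  rw [Finset.sum_comm]
  refine Finset.sum_congr rfl fun a _ => ?_
  conv_rhs => rw [sum_smul_e (b a), hf₂, Finset.mul_sum, ← sum_smul_e (b a)]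
  exact Finset.sum_congr rfl fun i _ => by ring

lemma sum_recip₂ (hb : IsFrame g b) (hs : ∀ u v, g u v = g v u)
    (α β : E4 [⋀^Fin 2]→L[ℝ] ℝ) :
    ∑ i, ∑ j, α ![recip g i, recip g j] * β ![e i, e j] =
      ∑ a, ∑ c, sgn a * sgn c * (α ![b a, b c] * β ![b a, b c]) := by
  have h1 : ∀ i, ∑ j, α ![recip g i, recip g j] * β ![e i, e j] =
      ∑ c, sgn c * (α ![recip g i, b c] * β ![e i, b c]) := fun i =>
    hb.sum_recip hs (fun x y => α ![recip g i, x] * β ![e i, y])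
      (fun c x y => by
        simp only [alt_cons_cons_sum, alt_cons_cons_smul, Finset.sum_mul, mul_assoc])
      (fun x c y => by
        simp only [alt_cons_cons_sum, alt_cons_cons_smul, Finset.mul_sum]
        exact Finset.sum_congr rfl fun _ _ => by ring)
  simp only [h1]
  have := hb.sum_recip hs (fun x y => ∑ c, sgn c * (α ![x, b c] * β ![y, b c]))
      (fun c x y => by
        simp only [alt_cons_sum, alt_cons_smul, Finset.sum_mul, Finset.mul_sum]
        rw [Finset.sum_comm]
        exact Finset.sum_congr rfl fun _ _ => Finset.sum_congr rfl fun _ _ => by ring)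
      (fun x c y => by
        simp only [alt_cons_sum, alt_cons_smul, Finset.mul_sum]
        rw [Finset.sum_comm]
        exact Finset.sum_congr rfl fun _ _ => Finset.sum_congr rfl fun _ _ => by ring)
  rw [this]
  simp only [Finset.mul_sum, mul_assoc]

lemma hodge2_apply_recip (g : Bilin4) (η : E4 [⋀^Fin 4]→L[ℝ] ℝ) (α : E4 [⋀^Fin 2]→L[ℝ] ℝ)
    (v w : E4) : hodge2 g η α ![v, w] =
      (1 / 2) * ∑ i, ∑ j, α ![recip g i, recip g j] * η ![e i, e j, v, w] := by
  simp [hodge2, ContinuousAlternatingMap.sum_apply, ContinuousAlternatingMap.smul_apply]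

/-- The last two slots of a 4-form filled. -/
def interior2 (η : E4 [⋀^Fin 4]→L[ℝ] ℝ) (v w : E4) : E4 [⋀^Fin 2]→L[ℝ] ℝ :=
  (η.curryLeft v).curryLeft w

/-- Exchanging two pairs is an even permutation. It is needed because `curryLeft` fills the leading
slots while the Hodge dual contracts them. -/
lemma alt_pairs (η : E4 [⋀^Fin 4]→L[ℝ] ℝ) (a b v w : E4) : η ![a, b, v, w] = η ![v, w, a, b] := by
  have s1 : ∀ a b c d, η ![a, b, c, d] = -η ![b, a, c, d] := fun a b c d => alt_swap η a b _
  have s2 : ∀ a b c d, η ![a, b, c, d] = -η ![a, c, b, d] := fun a b c d =>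
    alt_swap (η.curryLeft a) b c _
  have s3 : ∀ a b c d, η ![a, b, c, d] = -η ![a, b, d, c] := fun a b c d =>
    alt_swap ((η.curryLeft a).curryLeft b) c d _
  rw [s2, s1, s3, s2]; ring

lemma hodge2_apply (hb : IsFrame g b) (hs : ∀ u v, g u v = g v u) (η : E4 [⋀^Fin 4]→L[ℝ] ℝ)
    (α : E4 [⋀^Fin 2]→L[ℝ] ℝ) (v w : E4) : hodge2 g η α ![v, w] =
      (1 / 2) * ∑ a, ∑ c, sgn a * sgn c * (α ![b a, b c] * η ![b a, b c, v, w]) := by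
  rw [hodge2_apply_recip]
  have := hb.sum_recip₂ hs α (interior2 η v w)
  have h : ∀ a b, interior2 η v w ![a, b] = η ![a, b, v, w] := fun a b => (alt_pairs η a b v w).symm
  simp only [h] at this
  rw [this]

end IsFrame

lemma alt2_ext {α β : E4 [⋀^Fin 2]→L[ℝ] ℝ} (h : ∀ v w, α ![v, w] = β ![v, w]) : α = β := by
  ext v
  have : v = ![v 0, v 1] := by ext i; fin_cases i <;> rfl
  rw [this]; exact h _ _

/-- Naturality of the Hodge dual. -/
lemma hodge2_comp {g g' : Bilin4} {b : Fin 4 → E4} (hb : IsFrame g b) (hs : ∀ u v, g u v = g v u)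
    (η : E4 [⋀^Fin 4]→L[ℝ] ℝ) (α : E4 [⋀^Fin 2]→L[ℝ] ℝ) (L : E4 →L[ℝ] E4)
    (hL : Function.Surjective L) (hg : ∀ v w, g' v w = g (L v) (L w)) :
    hodge2 g' (η.compContinuousLinearMap L) (α.compContinuousLinearMap L) =
      (hodge2 g η α).compContinuousLinearMap L := by
  -- Lifting a frame of `g` through `L` gives a frame of `g'` in which all components agree.
  choose b' hb' using fun i => hL (b i)
  have hf : IsFrame g' b' := fun i j => by rw [hg, hb', hb', hb i j]
  have h2 : ∀ (β : E4 [⋀^Fin 2]→L[ℝ] ℝ) x y,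
      β.compContinuousLinearMap L ![x, y] = β ![L x, L y] := fun β x y => by
    rw [ContinuousAlternatingMap.compContinuousLinearMap_apply]
    congr 1; ext i; fin_cases i <;> rfl
  have h4 : ∀ (β : E4 [⋀^Fin 4]→L[ℝ] ℝ) x y z w,
      β.compContinuousLinearMap L ![x, y, z, w] = β ![L x, L y, L z, L w] := fun β x y z w => by
    rw [ContinuousAlternatingMap.compContinuousLinearMap_apply]
    congr 1; ext i; fin_cases i <;> rfl
  refine alt2_ext fun v w => ?_
  rw [hf.hodge2_apply (fun u v => by rw [hg, hg, hs]), h2, hb.hodge2_apply hs]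
  simp only [h2, h4, hb']

/-! ## Hodge duals in oriented orthonormal frames -/

/-- The Levi-Civita symbol. -/
def lc (i j k l : Fin 4) : ℤ :=
  ((j : ℤ) - i) * (k - i) * (l - i) * (k - j) * (l - j) * (l - k) / 12

/-- The product of differences is a Vandermonde determinant, which a permutation of its rows
multiplies by the sign; at 0, 1, 2, 3 it equals 12. -/
lemma lc_perm (σ : Equiv.Perm (Fin 4)) :
    lc (σ 0) (σ 1) (σ 2) (σ 3) = (Equiv.Perm.sign σ : ℤ) := by
  have hv : ∀ v : Fin 4 → ℤ, (Matrix.vandermonde v).det =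
      (v 1 - v 0) * (v 2 - v 0) * (v 3 - v 0) * (v 2 - v 1) * (v 3 - v 1) * (v 3 - v 2) := by
    intro v
    rw [Matrix.det_vandermonde]
    simp only [Fin.prod_univ_four]
    rw [show Finset.Ioi (0 : Fin 4) = {1, 2, 3} from rfl,
      show Finset.Ioi (1 : Fin 4) = {2, 3} from rfl, show Finset.Ioi (2 : Fin 4) = {3} from rfl,
      show Finset.Ioi (3 : Fin 4) = ∅ from rfl]
    simp [-mul_eq_mul_left_iff, -mul_eq_mul_right_iff]
    ring
  have h := Matrix.det_permute σ (Matrix.vandermonde (fun i : Fin 4 => (i : ℤ)))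
  have h' : (Matrix.vandermonde (fun i : Fin 4 => (i : ℤ))).submatrix σ id =
    Matrix.vandermonde (fun i : Fin 4 => (σ i : ℤ)) := rfl
  rw [h', hv, hv] at h
  unfold lc
  rw [h]
  simp

lemma lc_of_not_injective (v : Fin 4 → Fin 4) (hv : ¬ Function.Injective v) :
    lc (v 0) (v 1) (v 2) (v 3) = 0 := by
  simp only [Function.Injective, not_forall] at hv
  obtain ⟨x, y, hxy, hne⟩ := hv
  fin_cases x <;> fin_cases y <;> simp_all [lc]

lemma alt_frame (η : E4 [⋀^Fin 4]→L[ℝ] ℝ) {b : Fin 4 → E4} (hη : η b = 1) (i j k l : Fin 4) :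
    η ![b i, b j, b k, b l] = lc i j k l := by
  have h : ∀ v : Fin 4 → Fin 4, η (b ∘ v) = lc (v 0) (v 1) (v 2) (v 3) := by
    intro v
    by_cases hv : Function.Injective v
    · obtain ⟨σ, rfl⟩ : ∃ σ : Equiv.Perm (Fin 4), ⇑σ = v :=
        ⟨Equiv.ofBijective v hv.bijective_of_finite, rfl⟩
      have := η.toAlternatingMap.map_perm b σ
      rw [lc_perm]
      refine this.trans ?_
      have h1 : η.toAlternatingMap b = 1 := hη
      rw [h1, Units.smul_def]
      simp
    · rw [lc_of_not_injective v hv]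
      simp only [Function.Injective, not_forall] at hv
      obtain ⟨x, y, hxy, hne⟩ := hv
      rw [η.map_eq_zero_of_eq (b ∘ v) (i := x) (j := y) (by simp [hxy]) hne]
      simp
  have := h ![i, j, k, l]
  simp only [Matrix.cons_val] at this
  rw [← this]
  congr 1; ext m; fin_cases m <;> rfl

/-- Oriented orthonormal frames. -/
structure IsOriented (g : Bilin4) (η : E4 [⋀^Fin 4]→L[ℝ] ℝ) (b : Fin 4 → E4) : Prop where
  frame : IsFrame g b
  symm : ∀ u v, g u v = g v u
  vol : η b = 1

/-- The Hodge dual of antisymmetric components in an oriented orthonormal frame. -/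
def dual (f : Fin 4 → Fin 4 → ℝ) (k l : Fin 4) : ℝ :=
  (1 / 2) * ∑ a, ∑ c, sgn a * sgn c * (f a c * lc a c k l)

section dual

variable {f : Fin 4 → Fin 4 → ℝ} (hf : ∀ a c, f a c = -f c a)
include hf

/-- The dual exchanges 01 with 23, 02 with 13 and 03 with 12; in each pair exactly one direction
carries a minus sign, so the dual squares to -1. -/
lemma dual_01 : dual f 0 1 = f 2 3 := by
  simp [dual, Fin.sum_univ_four, sgn, lc, hf 3 2]; ring
lemma dual_23 : dual f 2 3 = -f 0 1 := by
  simp [dual, Fin.sum_univ_four, sgn, lc, hf 1 0]; ring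
lemma dual_02 : dual f 0 2 = -f 1 3 := by
  simp [dual, Fin.sum_univ_four, sgn, lc, hf 3 1]; ring
lemma dual_13 : dual f 1 3 = f 0 2 := by
  simp [dual, Fin.sum_univ_four, sgn, lc, hf 2 0]; ring
lemma dual_03 : dual f 0 3 = f 1 2 := by
  simp [dual, Fin.sum_univ_four, sgn, lc, hf 2 1]; ring
lemma dual_12 : dual f 1 2 = -f 0 3 := by
  simp [dual, Fin.sum_univ_four, sgn, lc, hf 3 0]; ring

end dual

namespace IsOriented

variable {g : Bilin4} {η : E4 [⋀^Fin 4]→L[ℝ] ℝ} {b : Fin 4 → E4}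

lemma hodge2_apply (hb : IsOriented g η b) (α : E4 [⋀^Fin 2]→L[ℝ] ℝ) (k l : Fin 4) :
    hodge2 g η α ![b k, b l] = dual (fun a c => α ![b a, b c]) k l := by
  rw [hb.frame.hodge2_apply hb.symm, dual]
  simp only [alt_frame η hb.vol]

lemma hodge3_apply (hb : IsOriented g η b) (γ : E4 [⋀^Fin 3]→L[ℝ] ℝ) (d : Fin 4) :
    hodge3 g η γ ![b d] = (1 / 6) * ∑ i, ∑ j, ∑ k,
      sgn i * sgn j * sgn k * (γ ![b i, b j, b k] * lc i j k d) := by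
  have h0 : hodge3 g η γ ![b d] = (1 / 6) * ∑ i, ∑ j, ∑ k,
      γ ![recip g i, recip g j, recip g k] * η ![e i, e j, e k, b d] := by
    simp [hodge3, ContinuousAlternatingMap.sum_apply, ContinuousAlternatingMap.smul_apply]
  -- Moving `b d` from the last slot to the first passes three arguments, whence the sign; the last
  -- two indices can then be contracted by `sum_recip₂` and the first by `sum_recip`.
  have h1 : ∀ z x y, η ![z, x, y, b d] = -(η.curryLeft (b d)).curryLeft z ![x, y] := by
    intro z x y
    have e1 : η ![z, x, y, b d] = η ![y, b d, z, x] := IsFrame.alt_pairs η _ _ _ _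
    have e2 : η ![y, b d, z, x] = - η ![b d, y, z, x] := alt_swap η _ _ _
    have e3 : η ![b d, y, z, x] = - η ![b d, z, y, x] := alt_swap (η.curryLeft (b d)) _ _ _
    have e4 : η ![b d, z, y, x] = - η ![b d, z, x, y] :=
      alt_swap ((η.curryLeft (b d)).curryLeft z) _ _ _
    have e5 : (η.curryLeft (b d)).curryLeft z ![x, y] = η ![b d, z, x, y] := rfl
    rw [e1, e2, e3, e4, e5]; ring
  have h2 : ∀ i, ∑ j, ∑ k, γ ![recip g i, recip g j, recip g k] * η ![e i, e j, e k, b d] =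
      ∑ j, ∑ k, sgn j * sgn k * (γ ![recip g i, b j, b k] * η ![e i, b j, b k, b d]) := by
    intro i
    have := hb.frame.sum_recip₂ hb.symm (γ.curryLeft (recip g i))
      (-(η.curryLeft (b d)).curryLeft (e i))
    simp only [ContinuousAlternatingMap.neg_apply, ← h1] at this
    exact this
  have h3 := hb.frame.sum_recip hb.symm
    (fun x y => ∑ j, ∑ k, sgn j * sgn k * (γ ![x, b j, b k] * η ![y, b j, b k, b d]))
      (fun c x y => by
        simp only [alt_cons_sum, alt_cons_smul, Finset.sum_mul, Finset.mul_sum]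
        rw [Finset.sum_comm_cycle]
        exact Finset.sum_congr rfl fun _ _ => Finset.sum_congr rfl fun _ _ =>
          Finset.sum_congr rfl fun _ _ => by ring)
      (fun x c y => by
        simp only [alt_cons_sum, alt_cons_smul, Finset.mul_sum]
        rw [Finset.sum_comm_cycle]
        exact Finset.sum_congr rfl fun _ _ => Finset.sum_congr rfl fun _ _ =>
          Finset.sum_congr rfl fun _ _ => by ring)
  rw [h0]
  simp only [h2]
  rw [h3]
  simp only [Finset.mul_sum, alt_frame η hb.vol]
  exact Finset.sum_congr rfl fun _ _ => Finset.sum_congr rfl fun _ _ =>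
          Finset.sum_congr rfl fun _ _ => by ring

/-- The dual of a 3-form vanishes iff its frame components do. -/
lemma hodge3_eq_zero_iff (hb : IsOriented g η b) (γ : E4 [⋀^Fin 3]→L[ℝ] ℝ) :
    hodge3 g η γ = 0 ↔ γ ![b 0, b 1, b 2] = 0 ∧ γ ![b 0, b 1, b 3] = 0 ∧
      γ ![b 0, b 2, b 3] = 0 ∧ γ ![b 1, b 2, b 3] = 0 := by
  have s1 : ∀ x y z, γ ![x, y, z] = -γ ![y, x, z] := fun x y z => alt_swap γ _ _ _
  have s2 : ∀ x y z, γ ![x, y, z] = -γ ![x, z, y] := fun x y z => alt_swap (γ.curryLeft x) _ _ _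
  have p : ∀ i j k, γ ![b j, b i, b k] = -γ ![b i, b j, b k] ∧
      γ ![b i, b k, b j] = -γ ![b i, b j, b k] ∧ γ ![b j, b k, b i] = γ ![b i, b j, b k] ∧
      γ ![b k, b i, b j] = γ ![b i, b j, b k] ∧ γ ![b k, b j, b i] = -γ ![b i, b j, b k] := by
    intro i j k
    have a1 := s1 (b i) (b j) (b k)
    have a2 := s2 (b i) (b j) (b k)
    have a3 := s2 (b j) (b i) (b k)
    have a4 := s1 (b i) (b k) (b j)
    have a5 := s2 (b k) (b i) (b j)
    refine ⟨?_, ?_, ?_, ?_, ?_⟩ <;> linarith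
  have h3 : hodge3 g η γ ![b 3] = -γ ![b 0, b 1, b 2] := by
    rw [hb.hodge3_apply]
    simp [Fin.sum_univ_four, sgn, lc, p 0 1 2]; ring
  have h2 : hodge3 g η γ ![b 2] = γ ![b 0, b 1, b 3] := by
    rw [hb.hodge3_apply]
    simp [Fin.sum_univ_four, sgn, lc, p 0 1 3]; ring
  have h1 : hodge3 g η γ ![b 1] = -γ ![b 0, b 2, b 3] := by
    rw [hb.hodge3_apply]
    simp [Fin.sum_univ_four, sgn, lc, p 0 2 3]; ring
  have h0 : hodge3 g η γ ![b 0] = -γ ![b 1, b 2, b 3] := by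
    rw [hb.hodge3_apply]
    simp [Fin.sum_univ_four, sgn, lc, p 1 2 3]; ring
  constructor
  · intro h
    rw [h] at h0 h1 h2 h3
    have z : ∀ v, (0 : E4 [⋀^Fin 1]→L[ℝ] ℝ) v = 0 := fun _ => by simp
    rw [z] at h0 h1 h2 h3
    refine ⟨?_, ?_, ?_, ?_⟩ <;> linarith
  · rintro ⟨a, c, d, f⟩
    rw [a] at h3; rw [c] at h2; rw [d] at h1; rw [f] at h0
    ext v
    have hv : v = ![v 0] := by ext i; fin_cases i; rfl
    rw [hv, hb.frame.expand (v 0), alt_cons_sum]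
    simp [alt_cons_smul, Fin.sum_univ_four, h0, h1, h2, h3]

end IsOriented

/-! ## Frames adapted to a unitary 2-form -/

/-- `U` is the area form of a time-like plane. -/
def IsUnitary (g : Bilin4) (U : E4 [⋀^Fin 2]→L[ℝ] ℝ) : Prop :=
  ∃ e₀ e₁ : E4, g e₀ e₀ = -1 ∧ g e₁ e₁ = 1 ∧ g e₀ e₁ = 0 ∧
    ∀ v w, U ![v, w] = g e₀ v * g e₁ w - g e₀ w * g e₁ v

/-- The orthogonal complement of a time-like vector is space-like. With spatial parts X, Y, one has
X·Y = x₀y₀ and |X|² = x₀² - 1; if |Y|² ≤ y₀², Cauchy-Schwarz gives x₀²y₀² ≤ (x₀² - 1)|Y|² ≤ x₀²y₀² -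
|Y|², so Y = 0 and then y₀ = 0. -/
lemma IsFrame.pos_of_orthogonal {g : Bilin4} {b : Fin 4 → E4} (hb : IsFrame g b)
    (hs : ∀ u v, g u v = g v u) {x y : E4} (hx : g x x = -1) (hxy : g x y = 0) (hy : y ≠ 0) :
    0 < g y y := by
  rw [hb.metric_eq hs] at hx hxy ⊢
  have hy' : ¬ ∀ a, g (b a) y = 0 := fun h => hy (by rw [hb.expand y]; simp [h])
  simp only [Fin.sum_univ_four, sgn_zero, sgn_one, sgn_two, sgn_three] at hx hxy ⊢
  simp only [Fin.forall_fin_succ, Fin.forall_fin_zero] at hy'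
  change ¬ (g (b 0) y = 0 ∧ g (b 1) y = 0 ∧ g (b 2) y = 0 ∧ g (b 3) y = 0 ∧ True) at hy'
  generalize g (b 0) x = x0 at *
  generalize g (b 1) x = x1 at *
  generalize g (b 2) x = x2 at *
  generalize g (b 3) x = x3 at *
  generalize g (b 0) y = y0 at *
  generalize g (b 1) y = y1 at *
  generalize g (b 2) y = y2 at *
  generalize g (b 3) y = y3 at *
  by_contra hneg
  have cs : (x1 * y1 + x2 * y2 + x3 * y3) ^ 2 ≤
      (x1 ^ 2 + x2 ^ 2 + x3 ^ 2) * (y1 ^ 2 + y2 ^ 2 + y3 ^ 2) := by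
    nlinarith [sq_nonneg (x1 * y2 - x2 * y1), sq_nonneg (x1 * y3 - x3 * y1),
      sq_nonneg (x2 * y3 - x3 * y2)]
  have e1 : x1 * y1 + x2 * y2 + x3 * y3 = x0 * y0 := by linarith
  have e2 : x1 ^ 2 + x2 ^ 2 + x3 ^ 2 = x0 ^ 2 - 1 := by linarith
  rw [e1, e2] at cs
  have e3 : y1 ^ 2 + y2 ^ 2 + y3 ^ 2 ≤ y0 ^ 2 := by nlinarith
  have hx0 : 1 ≤ x0 ^ 2 := by nlinarith [sq_nonneg x1, sq_nonneg x2, sq_nonneg x3]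
  have e4 : y1 ^ 2 + y2 ^ 2 + y3 ^ 2 ≤ 0 := by nlinarith
  have z1 : y1 = 0 := by nlinarith [sq_nonneg y1, sq_nonneg y2, sq_nonneg y3]
  have z2 : y2 = 0 := by nlinarith [sq_nonneg y1, sq_nonneg y2, sq_nonneg y3]
  have z3 : y3 = 0 := by nlinarith [sq_nonneg y1, sq_nonneg y2, sq_nonneg y3]
  subst z1 z2 z3
  have z0 : y0 ^ 2 = 0 := by nlinarith [sq_nonneg y0]
  exact hy' ⟨by simpa using z0, rfl, rfl, rfl, trivial⟩

lemma exists_orthogonal (g : Bilin4) (x y z : E4) :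
    ∃ v : E4, v ≠ 0 ∧ g x v = 0 ∧ g y v = 0 ∧ g z v = 0 := by
  let f : E4 →ₗ[ℝ] (Fin 3 → ℝ) := LinearMap.pi ![(g x : E4 →ₗ[ℝ] ℝ), (g y : E4 →ₗ[ℝ] ℝ), g z]
  have h := LinearMap.ker_ne_bot_of_finrank_lt (f := f) (by simp)
  obtain ⟨v, hv, hv0⟩ := Submodule.exists_mem_ne_zero_of_ne_bot h
  have h' : f v = 0 := hv
  exact ⟨v, hv0, congrFun h' 0, congrFun h' 1, congrFun h' 2⟩

lemma exists_unit (g : Bilin4) (v : E4) (hv : 0 < g v v) :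
    ∃ c : ℝ, g (c • v) (c • v) = 1 := by
  refine ⟨(Real.sqrt (g v v))⁻¹, ?_⟩
  have h := Real.mul_self_sqrt hv.le
  have h0 : Real.sqrt (g v v) ≠ 0 := (Real.sqrt_pos.mpr hv).ne'
  simp only [map_smul, smul_apply, smul_eq_mul]
  nth_rewrite 3 [← h]
  field_simp

/-- Oriented orthonormal frames `b` with `U = b₀♭ ∧ b₁♭`. -/
structure IsAdapted (g : Bilin4) (η : E4 [⋀^Fin 4]→L[ℝ] ℝ) (U : E4 [⋀^Fin 2]→L[ℝ] ℝ)
    (b : Fin 4 → E4) : Prop extends IsOriented g η b where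
  form : ∀ v w, U ![v, w] = g (b 0) v * g (b 1) w - g (b 0) w * g (b 1) v

lemma isFrame_cons {g : Bilin4} (hs : ∀ u v, g u v = g v u) {x y z w : E4}
    (h00 : g x x = -1) (h11 : g y y = 1) (h22 : g z z = 1) (h33 : g w w = 1) (h01 : g x y = 0)
    (h02 : g x z = 0) (h12 : g y z = 0) (h03 : g x w = 0) (h13 : g y w = 0) (h23 : g z w = 0) :
    IsFrame g ![x, y, z, w] := by
  intro i j
  fin_cases i <;> fin_cases j <;> simp [sgn, h00, h11, h01, h02, h12, h03, h13, h23, h33, h22,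
    hs y x, hs z x, hs z y, hs w x, hs w y, hs w z]

lemma IsFrame.vol_sq {g : Bilin4} {η : E4 [⋀^Fin 4]→L[ℝ] ℝ} {b : Fin 4 → E4} (hb : IsFrame g b)
    (hη : ∀ v, (η v) ^ 2 = -(Matrix.of fun i j => g (v i) (v j)).det) : (η b) ^ 2 = 1 := by
  have : (Matrix.of fun i j => g (b i) (b j)) = Matrix.diagonal sgn := by
    ext i j
    rw [Matrix.of_apply, hb i j, Matrix.diagonal_apply]
  rw [hη, this, Matrix.det_diagonal, Fin.prod_univ_four, sgn_zero, sgn_one, sgn_two, sgn_three]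
  norm_num

/-- The complement of e₀, e₁ is positive definite, so two unit vectors complete the frame. Changing
the sign of the last one corrects the orientation without affecting U. -/
lemma exists_isAdapted {g : Bilin4} {η : E4 [⋀^Fin 4]→L[ℝ] ℝ} {U : E4 [⋀^Fin 2]→L[ℝ] ℝ}
    {b : Fin 4 → E4} (hb : IsFrame g b) (hs : ∀ u v, g u v = g v u)
    (hη : ∀ v, (η v) ^ 2 = -(Matrix.of fun i j => g (v i) (v j)).det) (hU : IsUnitary g U) :
    ∃ b, IsAdapted g η U b := by
  obtain ⟨e₀, e₁, h00, h11, h01, hU⟩ := hU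
  -- Only two conditions are wanted here, so `e₁` is repeated.
  obtain ⟨v, hv, hv0, hv1, -⟩ := exists_orthogonal g e₀ e₁ e₁
  obtain ⟨c, hc⟩ := exists_unit g v (hb.pos_of_orthogonal hs h00 hv0 hv)
  have h02 : g e₀ (c • v) = 0 := by simp [hv0]
  have h12 : g e₁ (c • v) = 0 := by simp [hv1]
  generalize c • v = e₂ at hc h02 h12
  obtain ⟨w, hw, hw0, hw1, hw2⟩ := exists_orthogonal g e₀ e₁ e₂
  obtain ⟨d, hd⟩ := exists_unit g w (hb.pos_of_orthogonal hs h00 hw0 hw)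
  have h03 : g e₀ (d • w) = 0 := by simp [hw0]
  have h13 : g e₁ (d • w) = 0 := by simp [hw1]
  have h23 : g e₂ (d • w) = 0 := by simp [hw2]
  generalize d • w = e₃ at hd h03 h13 h23
  have f1 := isFrame_cons hs h00 h11 hc hd h01 h02 h12 h03 h13 h23
  have f2 := isFrame_cons hs h00 h11 hc (w := -e₃) (by simpa using hd) h01 h02 h12 (by simp [h03])
    (by simp [h13]) (by simp [h23])
  have hneg : η ![e₀, e₁, e₂, -e₃] = - η ![e₀, e₁, e₂, e₃] := by
    rw [IsFrame.alt_pairs, ← neg_one_smul ℝ e₃, alt_cons_cons_smul, IsFrame.alt_pairs,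
      neg_one_mul]
  rcases sq_eq_one_iff.mp (f1.vol_sq hη) with h | h
  · exact ⟨_, ⟨f1, hs, h⟩, hU⟩
  · exact ⟨_, ⟨f2, hs, by rw [hneg, h, neg_neg]⟩, hU⟩

namespace IsAdapted

variable {g : Bilin4} {η : E4 [⋀^Fin 4]→L[ℝ] ℝ} {U : E4 [⋀^Fin 2]→L[ℝ] ℝ} {b : Fin 4 → E4}

lemma form_frame (hb : IsAdapted g η U b) (i j : Fin 4) : U ![b i, b j] =
    (if (0 = i) then sgn 0 else 0) * (if (1 = j) then sgn 1 else 0) -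
      (if (0 = j) then sgn 0 else 0) * (if (1 = i) then sgn 1 else 0) := by
  rw [hb.form, hb.frame, hb.frame, hb.frame, hb.frame]

lemma form_01 (hb : IsAdapted g η U b) : U ![b 0, b 1] = -1 := by
  rw [hb.form_frame]; simp [sgn]
lemma form_02 (hb : IsAdapted g η U b) : U ![b 0, b 2] = 0 := by
  rw [hb.form_frame]; simp
lemma form_03 (hb : IsAdapted g η U b) : U ![b 0, b 3] = 0 := by
  rw [hb.form_frame]; simp
lemma form_12 (hb : IsAdapted g η U b) : U ![b 1, b 2] = 0 := by
  rw [hb.form_frame]; simp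
lemma form_13 (hb : IsAdapted g η U b) : U ![b 1, b 3] = 0 := by
  rw [hb.form_frame]; simp
lemma form_23 (hb : IsAdapted g η U b) : U ![b 2, b 3] = 0 := by
  rw [hb.form_frame]; simp

lemma hodge2_form (hb : IsAdapted g η U b) (v w : E4) :
    hodge2 g η U ![v, w] = g (b 2) v * g (b 3) w - g (b 2) w * g (b 3) v := by
  have hc : ∀ k l, hodge2 g η U ![b k, b l] =
      (if (2 = k) then 1 else 0) * (if (3 = l) then 1 else 0) -
      (if (2 = l) then 1 else 0) * (if (3 = k) then 1 else 0) := by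
    intro k l
    rw [hb.hodge2_apply, dual]
    simp only [hb.form_frame]
    fin_cases k <;> fin_cases l <;> simp [Fin.sum_univ_four, sgn, lc] <;> norm_num
  conv_lhs => rw [hb.frame.expand v, hb.frame.expand w]
  simp only [alt_cons_sum, alt_cons_smul, alt_cons_cons_sum, alt_cons_cons_smul, hc]
  simp [Fin.sum_univ_four, sgn]
  ring

end IsAdapted

/-! ## Calculus in a chart -/

section Smoothness

variable {V : Type*} [NormedAddCommGroup V] [NormedSpace ℝ V] {n : WithTop ℕ∞}

lemma contDiff_det {m : ℕ} :
    ContDiff ℝ n (fun A : Fin m → Fin m → ℝ => (Matrix.of A).det) := by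
  simp only [Matrix.det_apply, Matrix.of_apply]
  refine ContDiff.sum fun σ _ => ?_
  simp only [Units.smul_def, zsmul_eq_mul]
  refine contDiff_const.mul (contDiff_prod fun i _ => ?_)
  fun_prop

lemma contDiffAt_inv_apply {A : Fin 4 → Fin 4 → ℝ} (hA : (Matrix.of A).det ≠ 0) (i j : Fin 4) :
    ContDiffAt ℝ n (fun A : Fin 4 → Fin 4 → ℝ => (Matrix.of A)⁻¹ i j) A := by
  simp only [Matrix.inv_def, Matrix.smul_apply, Ring.inverse_eq_inv', smul_eq_mul]
  refine (contDiff_det.contDiffAt.inv hA).mul (ContDiff.contDiffAt ?_)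
  simp only [Matrix.adjugate_apply]
  have hg : ContDiff ℝ n (fun (A : Fin 4 → Fin 4 → ℝ) (k l : Fin 4) =>
      (Matrix.of A).updateRow j (Pi.single i 1) k l) := ?_
  · exact (contDiff_det (m := 4)).comp hg
  refine contDiff_pi.mpr fun k => contDiff_pi.mpr fun l => ?_
  by_cases h : k = j
  · subst h; simp only [Matrix.updateRow_self]; fun_prop
  · simp only [Matrix.updateRow_ne h, Matrix.of_apply]; fun_prop

lemma contDiffAt_recip {G : V → Bilin4} {y : V} (hG : ContDiffAt ℝ n G y)
    (hdet : (gram (G y)).det ≠ 0) (i : Fin 4) : ContDiffAt ℝ n (fun y => recip (G y) i) y := by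
  have hg : ContDiffAt ℝ n (fun y (k l : Fin 4) => G y (e k) (e l)) y :=
    contDiffAt_pi.mpr fun k => contDiffAt_pi.mpr fun l =>
      (hG.clm_apply contDiffAt_const).clm_apply contDiffAt_const
  refine ContDiffAt.sum fun j _ => ?_
  have h : ContDiffAt ℝ n (fun y => (gram (G y))⁻¹ i j) y :=
    ContDiffAt.comp (g := fun A : Fin 4 → Fin 4 → ℝ => (Matrix.of A)⁻¹ i j) y
      (contDiffAt_inv_apply (n := n) hdet i j) hg
  exact h.smul contDiffAt_const

/-- Evaluation of 2-forms as a continuous bilinear form. -/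
def toBilin : (E4 [⋀^Fin 2]→L[ℝ] ℝ) →L[ℝ] Bilin4 :=
  let c0 : (E4 [⋀^Fin 0]→L[ℝ] ℝ) →L[ℝ] ℝ := ContinuousAlternatingMap.apply ℝ E4 ℝ ![]
  let c1 : (E4 [⋀^Fin 1]→L[ℝ] ℝ) →L[ℝ] E4 →L[ℝ] ℝ :=
    (ContinuousLinearMap.compL ℝ E4 (E4 [⋀^Fin 0]→L[ℝ] ℝ) ℝ c0).comp
      (ContinuousAlternatingMap.curryLeftLI (𝕜 := ℝ) (E := E4) (F := ℝ)
        (n := 0)).toContinuousLinearMap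
  (ContinuousLinearMap.compL ℝ E4 (E4 [⋀^Fin 1]→L[ℝ] ℝ) (E4 →L[ℝ] ℝ) c1).comp
    (ContinuousAlternatingMap.curryLeftLI (𝕜 := ℝ) (E := E4) (F := ℝ)
      (n := 1)).toContinuousLinearMap

lemma toBilin_apply (α : E4 [⋀^Fin 2]→L[ℝ] ℝ) (v w : E4) : toBilin α v w = α ![v, w] := rfl

lemma contDiffAt_alt2_apply {α : V → E4 [⋀^Fin 2]→L[ℝ] ℝ} {v w : V → E4} {y : V}
    (hα : ContDiffAt ℝ n α y) (hv : ContDiffAt ℝ n v y) (hw : ContDiffAt ℝ n w y) :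
    ContDiffAt ℝ n (fun y => α y ![v y, w y]) y := by
  have h : ContDiff ℝ n toBilin := ContinuousLinearMap.contDiff _
  have h1 : ContDiffAt ℝ n (fun y => toBilin (α y)) y := h.contDiffAt.comp y hα
  simp only [← toBilin_apply]
  exact (h1.clm_apply hv).clm_apply hw

lemma contDiffAt_hodge2 {G : V → Bilin4} {η : V → E4 [⋀^Fin 4]→L[ℝ] ℝ}
    {α : V → E4 [⋀^Fin 2]→L[ℝ] ℝ} {y : V} (hG : ContDiffAt ℝ n G y)
    (hdet : (gram (G y)).det ≠ 0) (hη : ContDiffAt ℝ n η y) (hα : ContDiffAt ℝ n α y) :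
    ContDiffAt ℝ n (fun y => hodge2 (G y) (η y) (α y)) y := by
  let c3 := (ContinuousAlternatingMap.curryLeftLI (𝕜 := ℝ) (E := E4) (F := ℝ)
          (n := 3)).toContinuousLinearMap
  let c2 := (ContinuousAlternatingMap.curryLeftLI (𝕜 := ℝ) (E := E4) (F := ℝ)
          (n := 2)).toContinuousLinearMap
  have h2 : ContDiff ℝ n c2 := ContinuousLinearMap.contDiff _
  have h3 : ContDiff ℝ n c3 := ContinuousLinearMap.contDiff _
  have hs : ∀ i j, ContDiffAt ℝ n (fun y => α y ![recip (G y) i, recip (G y) j] •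
      ((η y).curryLeft (e i)).curryLeft (e j)) y := fun i j => by
    have e1 : ContDiffAt ℝ n (fun y => (c3 (η y)) (e i)) y :=
      (h3.contDiffAt.comp y hη).clm_apply contDiffAt_const
    have e2 : ContDiffAt ℝ n (fun y => c2 (c3 (η y) (e i)) (e j)) y :=
      (h2.contDiffAt.comp y e1).clm_apply contDiffAt_const
    exact (contDiffAt_alt2_apply hα (contDiffAt_recip hG hdet i)
      (contDiffAt_recip hG hdet j)).smul e2
  have h4 : ContDiffAt ℝ n (fun y => ∑ i, ∑ j, α y ![recip (G y) i, recip (G y) j] •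
      ((η y).curryLeft (e i)).curryLeft (e j)) y :=
    ContDiffAt.sum fun i _ => ContDiffAt.sum fun j _ => hs i j
  have h5 : ContDiffAt ℝ n (fun _ : V => (1 / 2 : ℝ)) y := contDiffAt_const
  exact h5.smul h4

lemma HasDerivAt.alt2 {A : ℝ → E4 [⋀^Fin 2]→L[ℝ] ℝ} {A' : E4 [⋀^Fin 2]→L[ℝ] ℝ} {x z : ℝ → E4}
    {x' z' : E4} {t : ℝ} (hA : HasDerivAt A A' t) (hx : HasDerivAt x x' t)
    (hz : HasDerivAt z z' t) : HasDerivAt (fun t => A t ![x t, z t])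
      (A' ![x t, z t] + A t ![x', z t] + A t ![x t, z']) t := by
  simp only [← toBilin_apply]
  have h1 : HasDerivAt (fun t => toBilin (A t)) (toBilin A') t :=
    HasFDerivAt.comp_hasDerivAt (l := toBilin) t (ContinuousLinearMap.hasFDerivAt _) hA
  exact (h1.clm_apply hx).clm_apply hz

end Smoothness

/-- The expression in a chart, near a point, of an oriented spacetime. -/
structure LocalSpacetime where
  /-- the metric -/
  G : E4 → Bilin4
  /-- the volume form -/
  η : E4 → E4 [⋀^Fin 4]→L[ℝ] ℝ
  /-- the point -/
  y₀ : E4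
  symm : ∀ y u v, G y u v = G y v u
  frame : ∀ᶠ y in nhds y₀, ∃ b, IsFrame (G y) b
  vol_sq : ∀ y v, (η y v) ^ 2 = -(Matrix.of fun i j => G y (v i) (v j)).det
  smooth_G : ContDiffAt ℝ ∞ G y₀
  smooth_η : ContDiffAt ℝ ∞ η y₀

namespace LocalSpacetime

variable (S : LocalSpacetime)

/-- The Christoffel symbols. -/
def Γ (u v : E4) : E4 :=
  ∑ i, ((1 / 2 : ℝ) * (fderiv ℝ S.G S.y₀ u v (e i) + fderiv ℝ S.G S.y₀ v u (e i)
    - fderiv ℝ S.G S.y₀ (e i) u v)) • recip (S.G S.y₀) i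

/-- The Levi-Civita covariant derivative of a 2-form. -/
def cov (α : E4 → E4 [⋀^Fin 2]→L[ℝ] ℝ) (u v w : E4) : ℝ :=
  fderiv ℝ α S.y₀ u ![v, w] - α S.y₀ ![S.Γ u v, w] - α S.y₀ ![v, S.Γ u w]

/-- The Hodge dual of a 2-form. -/
def star (α : E4 → E4 [⋀^Fin 2]→L[ℝ] ℝ) (y : E4) : E4 [⋀^Fin 2]→L[ℝ] ℝ :=
  hodge2 (S.G y) (S.η y) (α y)

lemma det_ne_zero : (gram (S.G S.y₀)).det ≠ 0 := by
  obtain ⟨b, hb⟩ := S.frame.self_of_nhds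
  exact hb.det_gram_ne_zero (S.symm _)

lemma smooth_star {α : E4 → E4 [⋀^Fin 2]→L[ℝ] ℝ} (hα : ContDiffAt ℝ ∞ α S.y₀) :
    ContDiffAt ℝ ∞ (S.star α) S.y₀ :=
  contDiffAt_hodge2 S.smooth_G S.det_ne_zero S.smooth_η hα

lemma hasFDerivAt_G : HasFDerivAt S.G (fderiv ℝ S.G S.y₀) S.y₀ :=
  (S.smooth_G.differentiableAt (by simp)).hasFDerivAt

lemma fderiv_symm (u v w : E4) : fderiv ℝ S.G S.y₀ u v w = fderiv ℝ S.G S.y₀ u w v := by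
  have h : ∀ v w, HasFDerivAt (fun y => S.G y v w) (((fderiv ℝ S.G S.y₀).flip v).flip w) S.y₀ := by
    intro v w
    refine ((S.hasFDerivAt_G.clm_apply (hasFDerivAt_const v S.y₀)).clm_apply
      (hasFDerivAt_const w S.y₀)).congr_fderiv ?_
    ext x
    simp
  have h1 := h v w
  simp only [fun y => S.symm y v w] at h1
  exact DFunLike.congr_fun (h1.unique (h w v)) u

/-- Absence of torsion. -/
lemma Γ_symm (u v : E4) : S.Γ u v = S.Γ v u := by
  refine Finset.sum_congr rfl fun i _ => ?_
  rw [S.fderiv_symm (e i) u v]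
  congr 1; ring

lemma metric_Γ (u v w : E4) : S.G S.y₀ (S.Γ u v) w = (1 / 2 : ℝ) *
    (fderiv ℝ S.G S.y₀ u v w + fderiv ℝ S.G S.y₀ v u w - fderiv ℝ S.G S.y₀ w u v) := by
  obtain ⟨b, hb⟩ := S.frame.self_of_nhds
  have h : ∀ i, S.G S.y₀ (recip (S.G S.y₀) i) w = w i := fun i => hb.metric_recip (S.symm _) i w
  simp only [Γ, map_sum, map_smul, sum_apply, smul_apply, h]
  conv_rhs => rw [sum_smul_e w]
  simp only [map_sum, map_smul, sum_apply, smul_apply, smul_eq_mul]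
  rw [← Finset.sum_add_distrib, ← Finset.sum_sub_distrib, Finset.mul_sum]
  exact Finset.sum_congr rfl fun i _ => by ring

/-- Metric compatibility ∇g = 0: in the sum of the two Koszul formulas the other derivatives cancel
by symmetry. -/
lemma fderiv_G (u v w : E4) :
    fderiv ℝ S.G S.y₀ u v w = S.G S.y₀ (S.Γ u v) w + S.G S.y₀ v (S.Γ u w) := by
  rw [S.symm _ v, metric_Γ, metric_Γ, S.fderiv_symm u w v, S.fderiv_symm v u w,
    S.fderiv_symm w u v]
  ring

/-- The Christoffel symbols as a bilinear map. -/
def ΓL (u : E4) : E4 →L[ℝ] E4 :=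
  LinearMap.toContinuousLinearMap
    { toFun := S.Γ u
      map_add' := fun v w => by
        simp only [Γ, map_add, add_apply, ← Finset.sum_add_distrib, ← add_smul]
        exact Finset.sum_congr rfl fun i _ => by congr 1; ring
      map_smul' := fun c v => by
        simp only [Γ, map_smul, smul_apply, Finset.smul_sum, smul_smul, smul_eq_mul,
          RingHom.id_apply]
        exact Finset.sum_congr rfl fun i _ => by congr 1; ring }

lemma ΓL_apply (u v : E4) : S.ΓL u v = S.Γ u v := rfl

/-- First-order parallel transport in the direction `u`. -/
def transport (u : E4) (t : ℝ) : E4 →L[ℝ] E4 := ContinuousLinearMap.id ℝ E4 - t • S.ΓL u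

lemma transport_zero (u v : E4) : S.transport u 0 v = v := by simp [transport]

lemma hasDerivAt_transport (u : E4) : HasDerivAt (S.transport u) (-S.ΓL u) 0 := by
  have := (hasDerivAt_id (0 : ℝ)).smul_const (S.ΓL u)
  simpa [transport] using! this.const_sub (ContinuousLinearMap.id ℝ E4)

/-- The transport is the identity at t = 0, and invertible operators form an open set. -/
lemma transport_surjective (u : E4) :
    ∀ᶠ t in nhds (0 : ℝ), Function.Surjective (S.transport u t) := by
  have h1 : IsUnit (S.transport u 0) := by
    have : S.transport u 0 = 1 := by ext v; simp [transport]
    rw [this]; exact isUnit_one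
  have h2 := (S.hasDerivAt_transport u).continuousAt.eventually_mem (Units.isOpen.mem_nhds h1)
  filter_upwards [h2] with t ht
  obtain ⟨U, hU⟩ := ht
  intro x
  refine ⟨(U⁻¹ : (E4 →L[ℝ] E4)ˣ).val x, ?_⟩
  rw [← hU]
  exact DFunLike.congr_fun U.mul_inv x

/-- The straight line through the base point. -/
def line (u : E4) (t : ℝ) : E4 := S.y₀ + t • u

lemma line_zero (u : E4) : S.line u 0 = S.y₀ := by simp [line]

lemma hasDerivAt_line (u : E4) : HasDerivAt (S.line u) u 0 := by
  have h : HasDerivAt (fun t : ℝ => S.y₀ + t • u) ((1 : ℝ) • u) 0 :=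
    ((hasDerivAt_id (0 : ℝ)).smul_const u).const_add S.y₀
  rwa [one_smul] at h

lemma tendsto_line (u : E4) : Filter.Tendsto (S.line u) (nhds 0) (nhds S.y₀) := by
  have := (S.hasDerivAt_line u).continuousAt.tendsto
  rwa [line_zero] at this

/-- The transported metric. -/
def metricT (u : E4) (t : ℝ) : Bilin4 :=
  (S.G (S.line u t)).bilinearComp (S.transport u t) (S.transport u t)

lemma metricT_apply (u : E4) (t : ℝ) (v w : E4) :
    S.metricT u t v w = S.G (S.line u t) (S.transport u t v) (S.transport u t w) := rfl

/-- A transported form. -/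
def formT {k : ℕ} (α : E4 → E4 [⋀^Fin k]→L[ℝ] ℝ) (u : E4) (t : ℝ) : E4 [⋀^Fin k]→L[ℝ] ℝ :=
  (α (S.line u t)).compContinuousLinearMap (S.transport u t)

lemma metricT_zero (u : E4) : S.metricT u 0 = S.G S.y₀ := by
  ext v w; rw [metricT_apply, transport_zero, transport_zero, line_zero]

lemma formT_zero {k : ℕ} (α : E4 → E4 [⋀^Fin k]→L[ℝ] ℝ) (u : E4) : S.formT α u 0 = α S.y₀ := by
  ext v
  rw [formT, line_zero, ContinuousAlternatingMap.compContinuousLinearMap_apply]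
  congr 1; ext i : 1; exact S.transport_zero u _

lemma formT_apply₂ (α : E4 → E4 [⋀^Fin 2]→L[ℝ] ℝ) (u : E4) (t : ℝ) (v w : E4) :
    S.formT α u t ![v, w] = α (S.line u t) ![S.transport u t v, S.transport u t w] := by
  rw [formT, ContinuousAlternatingMap.compContinuousLinearMap_apply]
  congr 1; ext i : 1; fin_cases i <;> rfl

lemma hasDerivAt_transport_apply (u v : E4) :
    HasDerivAt (fun t => S.transport u t v) (-S.Γ u v) 0 := by
  have := (S.hasDerivAt_transport u).clm_apply (hasDerivAt_const (0 : ℝ) v)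
  simpa [ΓL_apply] using this

/-- The derivative of the metric is cancelled by the two Christoffel terms from the transport. Thus
identities between the metric and forms can be differentiated as if the metric were constant. -/
lemma hasDerivAt_metricT (u v w : E4) : HasDerivAt (fun t => S.metricT u t v w) 0 0 := by
  simp only [metricT_apply]
  have h1 : HasDerivAt (fun t => S.G (S.line u t)) (fderiv ℝ S.G S.y₀ u) 0 := by
    exact HasFDerivAt.comp_hasDerivAt_of_eq (l := S.G) (0 : ℝ) S.hasFDerivAt_G
      (S.hasDerivAt_line u) (S.line_zero u).symm
  have := (h1.clm_apply (S.hasDerivAt_transport_apply u v)).clm_apply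
    (S.hasDerivAt_transport_apply u w)
  refine this.congr_deriv ?_
  simp only [transport_zero, line_zero, map_neg, add_apply, neg_apply, S.fderiv_G]
  ring

lemma hasDerivAt_recipT (u : E4) (i : Fin 4) :
    HasDerivAt (fun t => recip (S.metricT u t) i) 0 0 := by
  -- The inverse Gram matrix depends smoothly on a matrix whose derivative is zero.
  have key : ∀ j, HasDerivAt (fun t => (gram (S.metricT u t))⁻¹ i j) 0 0 := by
    intro j
    have h1 : HasDerivAt (fun t (k l : Fin 4) => S.metricT u t (e k) (e l)) 0 0 :=
      hasDerivAt_pi.mpr fun k => hasDerivAt_pi.mpr fun l => S.hasDerivAt_metricT u _ _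
    have h2 := (contDiffAt_inv_apply (n := 1) (A := fun k l => S.metricT u 0 (e k) (e l))
      (by rw [metricT_zero]; exact S.det_ne_zero) i j).differentiableAt (by simp)
    have := h2.hasFDerivAt.comp_hasDerivAt (0 : ℝ) h1
    rw [map_zero] at this
    exact this
  have := HasDerivAt.fun_sum (u := Finset.univ) fun j _ => (key j).smul_const (e j)
  simp only [zero_smul, Finset.sum_const_zero] at this
  exact this

section Forms

variable {S} {α : E4 → E4 [⋀^Fin 2]→L[ℝ] ℝ} (hα : ContDiffAt ℝ ∞ α S.y₀)

lemma differentiableAt_formT {k : ℕ} {β : E4 → E4 [⋀^Fin k]→L[ℝ] ℝ}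
    (hβ : ContDiffAt ℝ ∞ β S.y₀) (u : E4) : DifferentiableAt ℝ (S.formT β u) 0 := by
  have h0 : DifferentiableAt ℝ β (S.line u 0) := by
    rw [line_zero]; exact hβ.differentiableAt (by simp)
  exact (h0.comp (0 : ℝ) (S.hasDerivAt_line u).differentiableAt
    ).continuousAlternatingMapCompContinuousLinearMap (S.hasDerivAt_transport u).differentiableAt

include hα

/-- The product rule applied to the form and its two transported arguments reproduces the
Christoffel terms of the covariant derivative. -/
lemma hasDerivAt_formT_apply (u v w : E4) :
    HasDerivAt (fun t => S.formT α u t ![v, w]) (S.cov α u v w) 0 := by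
  simp only [formT_apply₂]
  have h1 : HasDerivAt (fun t => α (S.line u t)) (fderiv ℝ α S.y₀ u) 0 := by
    exact HasFDerivAt.comp_hasDerivAt_of_eq (l := α) (0 : ℝ)
      (hα.differentiableAt (by simp)).hasFDerivAt (S.hasDerivAt_line u) (S.line_zero u).symm
  refine (HasDerivAt.alt2 h1 (S.hasDerivAt_transport_apply u v)
    (S.hasDerivAt_transport_apply u w)).congr_deriv ?_
  simp only [transport_zero, line_zero, cov, ← toBilin_apply, map_neg, neg_apply]
  ring

/-- The covariant derivative in a given direction is a 2-form. -/
lemma deriv_formT_apply (u v w : E4) : deriv (S.formT α u) 0 ![v, w] = S.cov α u v w := by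
  have := HasDerivAt.alt2 (differentiableAt_formT hα u).hasDerivAt (hasDerivAt_const 0 v)
    (hasDerivAt_const 0 w)
  simp only [← toBilin_apply, map_zero, zero_apply, add_zero] at this
  have h := this.unique (hasDerivAt_formT_apply hα u v w)
  exact h

end Forms

/-- The volume form is parallel: on a frame its square is minus a determinant of metric components,
stationary at t = 0, and its value is nonzero, so its derivative vanishes on the frame. A form of
top degree is determined by one basis. -/
lemma deriv_vol (u : E4) : HasDerivAt (S.formT S.η u) 0 0 := by
  have hd := (differentiableAt_formT (S := S) S.smooth_η u).hasDerivAt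
  suffices h : deriv (S.formT S.η u) 0 = 0 by rwa [h] at hd
  obtain ⟨b, hb⟩ := S.frame.self_of_nhds
  have hev : ∀ v, HasDerivAt (fun t => S.formT S.η u t v) (deriv (S.formT S.η u) 0 v) 0 :=
    fun v => (ContinuousAlternatingMap.apply ℝ E4 ℝ v).hasFDerivAt.comp_hasDerivAt (0 : ℝ) hd
  have hsq : ∀ t, (S.formT S.η u t b) ^ 2 =
      -(Matrix.of fun i j => S.metricT u t (b i) (b j)).det := fun t => S.vol_sq _ _
  have h1 : HasDerivAt (fun t => -(Matrix.of fun i j => S.metricT u t (b i) (b j)).det) 0 0 := by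
    have h2 : HasDerivAt (fun t (k l : Fin 4) => S.metricT u t (b k) (b l)) 0 0 :=
      hasDerivAt_pi.mpr fun k => hasDerivAt_pi.mpr fun l => S.hasDerivAt_metricT u _ _
    have := ((contDiff_det (n := 1) (m := 4)).differentiable (by simp)
      (fun k l : Fin 4 => S.metricT u 0 (b k) (b l))).hasFDerivAt.comp_hasDerivAt (0 : ℝ) h2
    rw [map_zero] at this
    simpa using! this.neg
  have h3 := (hev b).fun_pow 2
  simp only [hsq] at h3
  have h4 := h3.unique h1
  have h5 : S.formT S.η u 0 b ≠ 0 := by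
    have := hb.vol_sq (S.vol_sq S.y₀)
    rw [S.formT_zero]
    intro h0; rw [h0] at this; norm_num at this
  have h6 : deriv (S.formT S.η u) 0 b = 0 := by
    simpa [h5] using h4
  have h7 : (deriv (S.formT S.η u) 0).toAlternatingMap = 0 := by
    refine Module.Basis.ext_alternating hb.basis fun v hv => ?_
    obtain ⟨σ, rfl⟩ : ∃ σ : Equiv.Perm (Fin 4), ⇑σ = v :=
      ⟨Equiv.ofBijective v hv.bijective_of_finite, rfl⟩
    have := (deriv (S.formT S.η u) 0).toAlternatingMap.map_perm b σ
    simp only [IsFrame.basis_apply]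
    refine this.trans ?_
    have h8 : (deriv (S.formT S.η u) 0).toAlternatingMap b = 0 := h6
    rw [h8]; simp
  ext v
  exact DFunLike.congr_fun h7 v

end LocalSpacetime
-- Covariant derivatives of duals, of unitary forms and of fields in a kernel.
namespace LocalSpacetime

variable {S : LocalSpacetime} {α : E4 → E4 [⋀^Fin 2]→L[ℝ] ℝ}

lemma hasDerivAt_formT_recip (hα : ContDiffAt ℝ ∞ α S.y₀) (u : E4) (i j : Fin 4) :
    HasDerivAt (fun t => S.formT α u t ![recip (S.metricT u t) i, recip (S.metricT u t) j])
      (S.cov α u (recip (S.G S.y₀) i) (recip (S.G S.y₀) j)) 0 := by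
  refine (HasDerivAt.alt2 (differentiableAt_formT hα u).hasDerivAt (S.hasDerivAt_recipT u i)
    (S.hasDerivAt_recipT u j)).congr_deriv ?_
  simp only [← toBilin_apply, map_zero, zero_apply, add_zero]
  simp only [toBilin_apply, deriv_formT_apply hα, metricT_zero]

/-- The transported Hodge dual is the Hodge dual with respect to the transported metric. -/
lemma formT_star (α : E4 → E4 [⋀^Fin 2]→L[ℝ] ℝ) (u : E4) : ∀ᶠ t in nhds (0 : ℝ),
    S.formT (S.star α) u t = hodge2 (S.metricT u t) (S.formT S.η u t) (S.formT α u t) := by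
  filter_upwards [S.transport_surjective u, (S.tendsto_line u).eventually S.frame] with t h1 h2
  obtain ⟨b, hb⟩ := h2
  exact (hodge2_comp hb (S.symm _) _ _ _ h1 (S.metricT_apply u t)).symm

/-- The Hodge dual is parallel. -/
lemma cov_star (hα : ContDiffAt ℝ ∞ α S.y₀) {b : Fin 4 → E4}
    (hb : IsOriented (S.G S.y₀) (S.η S.y₀) b) (u : E4) (k l : Fin 4) :
    S.cov (S.star α) u (b k) (b l) = dual (fun a c => S.cov α u (b a) (b c)) k l := by
  have h1 := hasDerivAt_formT_apply (S.smooth_star hα) u (b k) (b l)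
  have h2 : (fun t => S.formT (S.star α) u t ![b k, b l]) =ᶠ[nhds 0] fun t => (1 / 2) * ∑ i, ∑ j,
      S.formT α u t ![recip (S.metricT u t) i, recip (S.metricT u t) j] *
        S.formT S.η u t ![e i, e j, b k, b l] := by
    filter_upwards [formT_star α u] with t ht
    rw [ht, IsFrame.hodge2_apply_recip]
  have h3 : ∀ v, HasDerivAt (fun t => S.formT S.η u t v) 0 0 := fun v =>
    HasFDerivAt.comp_hasDerivAt (l := fun β : E4 [⋀^Fin 4]→L[ℝ] ℝ => β v) (0 : ℝ)
      (ContinuousAlternatingMap.apply ℝ E4 ℝ v).hasFDerivAt (S.deriv_vol u)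
  -- The reciprocal basis and the volume have zero derivative, so only the derivative of the form
  -- itself contributes.
  have h4 : HasDerivAt (fun t => (1 / 2) * ∑ i, ∑ j,
      S.formT α u t ![recip (S.metricT u t) i, recip (S.metricT u t) j] *
        S.formT S.η u t ![e i, e j, b k, b l])
      ((1 / 2) * ∑ i, ∑ j, deriv (S.formT α u) 0 ![recip (S.G S.y₀) i, recip (S.G S.y₀) j] *
        S.η S.y₀ ![e i, e j, b k, b l]) 0 := by
    refine HasDerivAt.const_mul _ (HasDerivAt.fun_sum fun i _ => HasDerivAt.fun_sum fun j _ => ?_)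
    refine ((hasDerivAt_formT_recip hα u i j).mul (h3 _)).congr_deriv ?_
    rw [mul_zero, add_zero, formT_zero, deriv_formT_apply hα]
  rw [h1.unique (h4.congr_of_eventuallyEq h2), ← IsFrame.hodge2_apply_recip, hb.hodge2_apply]
  simp only [deriv_formT_apply hα]

lemma cov_swap (hα : ContDiffAt ℝ ∞ α S.y₀) (u v w : E4) : S.cov α u v w = -S.cov α u w v := by
  rw [← deriv_formT_apply hα, ← deriv_formT_apply hα]
  exact alt_swap _ _ _ _

/-- Pull-backs of unitary forms are unitary. -/
lemma IsUnitary.comp {g g' : Bilin4} {U U' : E4 [⋀^Fin 2]→L[ℝ] ℝ} (hU : IsUnitary g U)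
    {L : E4 → E4} (hL : Function.Surjective L) (hg : ∀ v w, g' v w = g (L v) (L w))
    (hU' : ∀ v w, U' ![v, w] = U ![L v, L w]) : IsUnitary g' U' := by
  obtain ⟨e₀, e₁, h0, h1, h2, h⟩ := hU
  obtain ⟨f₀, rfl⟩ := hL e₀
  obtain ⟨f₁, rfl⟩ := hL e₁
  exact ⟨f₀, f₁, by rw [hg, h0], by rw [hg, h1], by rw [hg, h2],
    fun v w => by rw [hU', h, hg, hg, hg, hg]⟩

lemma isUnitary_formT (hU : ∀ᶠ y in nhds S.y₀, IsUnitary (S.G y) (α y)) (u : E4) :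
    ∀ᶠ t in nhds (0 : ℝ), IsUnitary (S.metricT u t) (S.formT α u t) := by
  filter_upwards [S.transport_surjective u, (S.tendsto_line u).eventually hU] with t h1 h2
  exact IsUnitary.comp h2 h1 (S.metricT_apply u t) (S.formT_apply₂ α u t)

lemma IsFrame.comp {g g' : Bilin4} {b : Fin 4 → E4} (hb : IsFrame g b)
    {L : E4 → E4} (hL : Function.Surjective L) (hg : ∀ v w, g' v w = g (L v) (L w)) :
    ∃ b', IsFrame g' b' := by
  choose b' hb' using fun i => hL (b i)
  exact ⟨b', fun i j => by rw [hg, hb', hb', hb i j]⟩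

/-- The norm of a unitary 2-form. -/
lemma norm_unitary {g : Bilin4} {η : E4 [⋀^Fin 4]→L[ℝ] ℝ} {U : E4 [⋀^Fin 2]→L[ℝ] ℝ}
    {b : Fin 4 → E4} (hb : IsFrame g b) (hs : ∀ u v, g u v = g v u)
    (hη : ∀ v, (η v) ^ 2 = -(Matrix.of fun i j => g (v i) (v j)).det) (hU : IsUnitary g U) :
    ∑ i, ∑ j, U ![recip g i, recip g j] * U ![e i, e j] = -2 := by
  obtain ⟨b, hb⟩ := exists_isAdapted hb hs hη hU
  rw [hb.frame.sum_recip₂ hs]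
  simp only [hb.form_frame]
  simp [Fin.sum_univ_four, sgn]
  norm_num

/-- Unitary 2-forms are decomposable. -/
lemma wedge_unitary {g : Bilin4} {U : E4 [⋀^Fin 2]→L[ℝ] ℝ} (hU : IsUnitary g U) (x y z w : E4) :
    U ![x, y] * U ![z, w] - U ![x, z] * U ![y, w] + U ![x, w] * U ![y, z] = 0 := by
  obtain ⟨e₀, e₁, -, -, -, h⟩ := hU
  simp only [h]
  ring

/-- Differentiate α∧α = 0 on the frame: every term but one contains a vanishing component of α, and
the factor α₀₁ = -1 leaves the component 23 of ∇α. -/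
lemma cov_unitary_23 (hα : ContDiffAt ℝ ∞ α S.y₀)
    (hU : ∀ᶠ y in nhds S.y₀, IsUnitary (S.G y) (α y)) {b : Fin 4 → E4}
    (hb : IsAdapted (S.G S.y₀) (S.η S.y₀) (α S.y₀) b) (u : E4) : S.cov α u (b 2) (b 3) = 0 := by
  have h := fun v w => hasDerivAt_formT_apply hα u v w
  have h1 := (((h (b 0) (b 1)).fun_mul (h (b 2) (b 3))).fun_sub
    ((h (b 0) (b 2)).fun_mul (h (b 1) (b 3)))).fun_add
      ((h (b 0) (b 3)).fun_mul (h (b 1) (b 2)))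
  have hev : ∀ᶠ t in nhds (0 : ℝ), S.formT α u t ![b 0, b 1] * S.formT α u t ![b 2, b 3] -
      S.formT α u t ![b 0, b 2] * S.formT α u t ![b 1, b 3] +
      S.formT α u t ![b 0, b 3] * S.formT α u t ![b 1, b 2] = 0 := by
    filter_upwards [isUnitary_formT hU u] with t ht
    exact wedge_unitary ht (b 0) (b 1) (b 2) (b 3)
  have h2 := h1.unique ((hasDerivAt_const (0 : ℝ) (0 : ℝ)).congr_of_eventuallyEq hev)
  simp only [formT_zero, hb.form_01, hb.form_02, hb.form_03, hb.form_12, hb.form_13,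
    hb.form_23] at h2
  linarith

/-- Differentiate the constant norm α^{ij}α_{ij} = -2: as α has only the component 01, its product
with (∇α)₀₁ must vanish. -/
lemma cov_unitary_01 (hα : ContDiffAt ℝ ∞ α S.y₀)
    (hU : ∀ᶠ y in nhds S.y₀, IsUnitary (S.G y) (α y)) {b : Fin 4 → E4}
    (hb : IsAdapted (S.G S.y₀) (S.η S.y₀) (α S.y₀) b) (u : E4) : S.cov α u (b 0) (b 1) = 0 := by
  have hev : ∀ᶠ t in nhds (0 : ℝ), ∑ i, ∑ j,
      S.formT α u t ![recip (S.metricT u t) i, recip (S.metricT u t) j] *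
        S.formT α u t ![e i, e j] = -2 := by
    filter_upwards [isUnitary_formT hU u, S.transport_surjective u,
      (S.tendsto_line u).eventually S.frame] with t h1 h2 h3
    obtain ⟨c, hc⟩ := h3
    obtain ⟨c', hc'⟩ := IsFrame.comp hc h2 (S.metricT_apply u t)
    have hη : ∀ v, (S.formT S.η u t v) ^ 2 =
        -(Matrix.of fun i j => S.metricT u t (v i) (v j)).det :=
      fun v => S.vol_sq (S.line u t) (fun i => S.transport u t (v i))
    exact norm_unitary hc' (fun v w => S.symm _ _ _) hη h1
  have h4 : HasDerivAt (fun t => ∑ i, ∑ j,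
      S.formT α u t ![recip (S.metricT u t) i, recip (S.metricT u t) j] *
        S.formT α u t ![e i, e j])
      (∑ i, ∑ j, (deriv (S.formT α u) 0 ![recip (S.G S.y₀) i, recip (S.G S.y₀) j] *
        α S.y₀ ![e i, e j] + α S.y₀ ![recip (S.G S.y₀) i, recip (S.G S.y₀) j] *
        deriv (S.formT α u) 0 ![e i, e j])) 0 := by
    refine HasDerivAt.fun_sum fun i _ => HasDerivAt.fun_sum fun j _ => ?_
    refine ((hasDerivAt_formT_recip hα u i j).fun_mul
      (hasDerivAt_formT_apply hα u (e i) (e j))).congr_deriv ?_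
    rw [formT_zero, metricT_zero, deriv_formT_apply hα, deriv_formT_apply hα]
  have h5 := h4.unique ((hasDerivAt_const (0 : ℝ) (-2 : ℝ)).congr_of_eventuallyEq hev)
  simp only [Finset.sum_add_distrib] at h5
  rw [hb.frame.sum_recip₂ hb.symm, hb.frame.sum_recip₂ hb.symm] at h5
  simp only [hb.form_frame, deriv_formT_apply hα] at h5
  simp [Fin.sum_univ_four, sgn, cov_swap hα u (b 1) (b 0)] at h5
  linarith

/-- The exterior derivative is the antisymmetrized covariant derivative. -/
lemma extDeriv_eq_cov (α : E4 → E4 [⋀^Fin 2]→L[ℝ] ℝ) (u v w : E4) :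
    extDeriv α S.y₀ ![u, v, w] = S.cov α u v w - S.cov α v u w + S.cov α w u v := by
  rw [extDeriv, ContinuousAlternatingMap.alternatizeUncurryFin_apply, Fin.sum_univ_three]
  have r0 : Fin.removeNth 0 ![u, v, w] = ![v, w] := by ext i : 1; fin_cases i <;> rfl
  have r1 : Fin.removeNth 1 ![u, v, w] = ![u, w] := by ext i : 1; fin_cases i <;> rfl
  have r2 : Fin.removeNth 2 ![u, v, w] = ![u, v] := by ext i : 1; fin_cases i <;> rfl
  rw [r0, r1, r2]
  have s : ∀ x y, α S.y₀ ![x, y] = - α S.y₀ ![y, x] := fun x y => alt_swap _ _ _ _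
  simp only [cov]
  -- By absence of torsion the six Christoffel terms cancel in pairs.
  rw [S.Γ_symm v u, S.Γ_symm w u, S.Γ_symm w v, s v (S.Γ u w), s u (S.Γ v w)]
  simp
  linarith [s (S.Γ u v) w]

lemma cov_add_left (α : E4 → E4 [⋀^Fin 2]→L[ℝ] ℝ) (u u' v w : E4) :
    S.cov α (u + u') v w = S.cov α u v w + S.cov α u' v w := by
  -- `ΓL` records linearity in the second argument only, so the direction is first moved there by
  -- symmetry.
  simp only [cov, S.Γ_symm (u + u'), S.Γ_symm u, S.Γ_symm u', ← ΓL_apply, map_add,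
    ← toBilin_apply, add_apply]
  ring

lemma cov_smul_left (α : E4 → E4 [⋀^Fin 2]→L[ℝ] ℝ) (c : ℝ) (u v w : E4) :
    S.cov α (c • u) v w = c * S.cov α u v w := by
  simp only [cov, S.Γ_symm (c • u), S.Γ_symm u, ← ΓL_apply, map_smul,
    ← toBilin_apply, smul_apply, smul_eq_mul]
  ring

/-- The covariant derivative of a vector field. -/
def covVec (S : LocalSpacetime) (X : E4 → E4) (u : E4) : E4 :=
  fderiv ℝ X S.y₀ u + S.Γ u (X S.y₀)

/-- Differentiate α(X, w) = 0. This turns the second fundamental form of ker α into components of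
∇α. -/
lemma cov_of_kernel (hα : ContDiffAt ℝ ∞ α S.y₀) {X : E4 → E4} (hX : ContDiffAt ℝ ∞ X S.y₀)
    (h : ∀ᶠ y in nhds S.y₀, ∀ w, α y ![X y, w] = 0) (u w : E4) :
    S.cov α u (X S.y₀) w = -α S.y₀ ![S.covVec X u, w] := by
  have hA : HasDerivAt (fun t => α (S.line u t)) (fderiv ℝ α S.y₀ u) 0 :=
    HasFDerivAt.comp_hasDerivAt_of_eq (l := α) (0 : ℝ)
      (hα.differentiableAt (by simp)).hasFDerivAt (S.hasDerivAt_line u) (S.line_zero u).symm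
  have hX' : HasDerivAt (fun t => X (S.line u t)) (fderiv ℝ X S.y₀ u) 0 :=
    HasFDerivAt.comp_hasDerivAt_of_eq (l := X) (0 : ℝ)
      (hX.differentiableAt (by simp)).hasFDerivAt (S.hasDerivAt_line u) (S.line_zero u).symm
  have h1 := HasDerivAt.alt2 hA hX' (hasDerivAt_const (0 : ℝ) w)
  have h2 := h1.unique ((hasDerivAt_const (0 : ℝ) (0 : ℝ)).congr_of_eventuallyEq
    (((S.tendsto_line u).eventually h).mono fun t ht => ht w))
  have h3 := h.self_of_nhds (S.Γ u w)
  simp only [line_zero, ← toBilin_apply, map_zero, add_zero] at h2 h3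
  simp only [cov, covVec, ← toBilin_apply, map_add, add_apply]
  linarith

/-- The Leibniz rule. -/
lemma cov_combination {β : E4 → E4 [⋀^Fin 2]→L[ℝ] ℝ} {p q : E4 → ℝ}
    (hα : ContDiffAt ℝ ∞ α S.y₀) (hβ : ContDiffAt ℝ ∞ β S.y₀) (hp : DifferentiableAt ℝ p S.y₀)
    (hq : DifferentiableAt ℝ q S.y₀) (u v w : E4) :
    S.cov (fun y => p y • α y + q y • β y) u v w =
      fderiv ℝ p S.y₀ u * α S.y₀ ![v, w] + p S.y₀ * S.cov α u v w +
        (fderiv ℝ q S.y₀ u * β S.y₀ ![v, w] + q S.y₀ * S.cov β u v w) := by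
  have h := ((hp.hasFDerivAt.fun_smul (hα.differentiableAt (by simp)).hasFDerivAt).fun_add
    (hq.hasFDerivAt.fun_smul (hβ.differentiableAt (by simp)).hasFDerivAt)).fderiv
  simp only [cov, h]
  simp [← toBilin_apply]
  ring

end LocalSpacetime
-- Umbilicity of the planes ker U and ker *U.
/-- The kernel of a 2-form. -/
def formKer (β : E4 [⋀^Fin 2]→L[ℝ] ℝ) : Set E4 := {x | ∀ w, β ![x, w] = 0}

namespace IsAdapted

variable {g : Bilin4} {η : E4 [⋀^Fin 4]→L[ℝ] ℝ} {U : E4 [⋀^Fin 2]→L[ℝ] ℝ} {b : Fin 4 → E4}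

lemma expand_four (hb : IsAdapted g η U b) (x : E4) : x = (-g (b 0) x) • b 0 + g (b 1) x • b 1 +
    g (b 2) x • b 2 + g (b 3) x • b 3 := by
  conv_lhs => rw [hb.frame.expand x]
  simp [Fin.sum_univ_four, sgn]

lemma metric_frame (hb : IsAdapted g η U b) : g (b 0) (b 0) = -1 ∧ g (b 1) (b 1) = 1 ∧
    g (b 2) (b 2) = 1 ∧ g (b 3) (b 3) = 1 ∧ (∀ i j, i ≠ j → g (b i) (b j) = 0) := by
  refine ⟨?_, ?_, ?_, ?_, fun i j hij => ?_⟩ <;> rw [hb.frame] <;> simp [sgn]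
  exact fun h => absurd h hij

lemma mem_formKer (hb : IsAdapted g η U b) (x : E4) :
    x ∈ formKer U ↔ g (b 0) x = 0 ∧ g (b 1) x = 0 := by
  obtain ⟨h0, h1, -, -, h⟩ := hb.metric_frame
  constructor
  · intro hx
    have e0 := hx (b 1)
    have e1 := hx (b 0)
    rw [hb.form, h1, h 0 1 (by decide)] at e0
    rw [hb.form, h0, h 1 0 (by decide)] at e1
    constructor <;> linarith
  · rintro ⟨e0, e1⟩ w
    rw [hb.form, e0, e1]; ring

lemma mem_formKer_star (hb : IsAdapted g η U b) (x : E4) :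
    x ∈ formKer (hodge2 g η U) ↔ g (b 2) x = 0 ∧ g (b 3) x = 0 := by
  obtain ⟨-, -, h2, h3, h⟩ := hb.metric_frame
  constructor
  · intro hx
    have e0 := hx (b 3)
    have e1 := hx (b 2)
    rw [hb.hodge2_form, h3, h 2 3 (by decide)] at e0
    rw [hb.hodge2_form, h2, h 3 2 (by decide)] at e1
    constructor <;> linarith
  · rintro ⟨e0, e1⟩ w
    rw [hb.hodge2_form, e0, e1]; ring

/-- The kernel of the dual form is the orthogonal complement of the kernel. -/
lemma mem_formKer_star_iff (hb : IsAdapted g η U b) (x : E4) :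
    x ∈ formKer (hodge2 g η U) ↔ ∀ w ∈ formKer U, g x w = 0 := by
  obtain ⟨h0, h1, h2, h3, h⟩ := hb.metric_frame
  rw [hb.mem_formKer_star]
  constructor
  · rintro ⟨e2, e3⟩ w hw
    rw [hb.mem_formKer] at hw
    rw [hb.frame.metric_eq hb.symm]
    simp [Fin.sum_univ_four, e2, e3, hw]
  · intro hx
    rw [hb.symm, hb.symm (b 3)]
    exact ⟨hx _ ((hb.mem_formKer _).mpr ⟨h 0 2 (by decide), h 1 2 (by decide)⟩),
      hx _ ((hb.mem_formKer _).mpr ⟨h 0 3 (by decide), h 1 3 (by decide)⟩)⟩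

lemma mem_formKer_iff (hb : IsAdapted g η U b) (x : E4) :
    x ∈ formKer U ↔ ∀ w ∈ formKer (hodge2 g η U), g x w = 0 := by
  obtain ⟨h0, h1, h2, h3, h⟩ := hb.metric_frame
  rw [hb.mem_formKer]
  constructor
  · rintro ⟨e2, e3⟩ w hw
    rw [hb.mem_formKer_star] at hw
    rw [hb.frame.metric_eq hb.symm]
    simp [Fin.sum_univ_four, e2, e3, hw]
  · intro hx
    rw [hb.symm, hb.symm (b 1)]
    exact ⟨hx _ ((hb.mem_formKer_star _).mpr ⟨h 2 0 (by decide), h 3 0 (by decide)⟩),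
      hx _ ((hb.mem_formKer_star _).mpr ⟨h 2 1 (by decide), h 3 1 (by decide)⟩)⟩

end IsAdapted

/-- Raising the index of a 1-form `β(v, ·)`. -/
def sharp (g : Bilin4) (β : E4 [⋀^Fin 2]→L[ℝ] ℝ) (v : E4) : E4 :=
  ∑ i, β ![v, e i] • recip g i

lemma metric_sharp {g : Bilin4} {b : Fin 4 → E4} (hb : IsFrame g b) (hs : ∀ u v, g u v = g v u)
    (β : E4 [⋀^Fin 2]→L[ℝ] ℝ) (v w : E4) : g (sharp g β v) w = β ![v, w] := by
  simp only [sharp, map_sum, map_smul, sum_apply, smul_apply, hb.metric_recip hs, smul_eq_mul]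
  conv_rhs => rw [sum_smul_e w]
  simp only [alt_cons_cons_sum, alt_cons_cons_smul]
  exact Finset.sum_congr rfl fun i _ => mul_comm _ _

namespace IsAdapted

variable {g : Bilin4} {η : E4 [⋀^Fin 4]→L[ℝ] ℝ} {U : E4 [⋀^Fin 2]→L[ℝ] ℝ} {b : Fin 4 → E4}

lemma ext_metric (hb : IsAdapted g η U b) {x y : E4} (h : ∀ w, g x w = g y w) : x = y := by
  rw [hb.frame.expand x, hb.frame.expand y]
  exact Finset.sum_congr rfl fun a _ => by rw [hb.symm _ x, hb.symm _ y, h]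

/-- Raising an index of *U produces vectors orthogonal to ker *U. With `v` fixed, these supply
smooth local fields tangent to ker U with prescribed value at the base point. -/
lemma sharp_star_mem (hb : IsAdapted g η U b) (v : E4) :
    sharp g (hodge2 g η U) v ∈ formKer U := by
  rw [hb.mem_formKer_iff]
  intro w hw
  rw [metric_sharp hb.frame hb.symm, ← neg_neg (hodge2 g η U ![v, w]), ← alt_swap, hw, neg_zero]

lemma sharp_mem (hb : IsAdapted g η U b) (v : E4) :
    sharp g U v ∈ formKer (hodge2 g η U) := by
  rw [hb.mem_formKer_star_iff]
  intro w hw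
  rw [metric_sharp hb.frame hb.symm, ← neg_neg (U ![v, w]), ← alt_swap, hw, neg_zero]

end IsAdapted

namespace LocalSpacetime

variable {S : LocalSpacetime}

lemma smooth_sharp {β : E4 → E4 [⋀^Fin 2]→L[ℝ] ℝ} (hβ : ContDiffAt ℝ ∞ β S.y₀) (v : E4) :
    ContDiffAt ℝ ∞ (fun y => sharp (S.G y) (β y) v) S.y₀ := by
  have h : ∀ i, ContDiffAt ℝ ∞ (fun y => β y ![v, e i] • recip (S.G y) i) S.y₀ := fun i =>
    (contDiffAt_alt2_apply hβ contDiffAt_const contDiffAt_const).smul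
      (contDiffAt_recip S.smooth_G S.det_ne_zero i)
  exact ContDiffAt.sum fun i _ => h i

/-- Umbilicity at the base point of a local plane field. -/
def IsUmbilicalAt (S : LocalSpacetime) (D : E4 → Set E4) : Prop :=
  ∃ n : E4, ∀ X Y : E4 → E4, ContDiffAt ℝ ∞ X S.y₀ → ContDiffAt ℝ ∞ Y S.y₀ →
    (∀ᶠ y in nhds S.y₀, X y ∈ D y) → (∀ᶠ y in nhds S.y₀, Y y ∈ D y) →
    ∀ z, (∀ w ∈ D S.y₀, S.G S.y₀ z w = 0) →
      (1 / 2 : ℝ) * S.G S.y₀ (S.covVec Y (X S.y₀) + S.covVec X (Y S.y₀)) z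
        = S.G S.y₀ (X S.y₀) (Y S.y₀) * S.G S.y₀ n z

lemma cov_add_mid {β : E4 → E4 [⋀^Fin 2]→L[ℝ] ℝ} (hβ : ContDiffAt ℝ ∞ β S.y₀) (u v v' w : E4) :
    S.cov β u (v + v') w = S.cov β u v w + S.cov β u v' w := by
  simp only [← deriv_formT_apply hβ]; exact alt_cons_add _ _ _ _

lemma cov_smul_mid {β : E4 → E4 [⋀^Fin 2]→L[ℝ] ℝ} (hβ : ContDiffAt ℝ ∞ β S.y₀) (c : ℝ)
    (u v w : E4) : S.cov β u (c • v) w = c * S.cov β u v w := by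
  simp only [← deriv_formT_apply hβ]; exact alt_cons_smul _ _ _ _

/-- Here d₀, d₁ is an orthonormal basis of ker β, with g(d₀, d₀) = ε, and o₀, o₁ span its
complement. As g(·, oᵢ) = β(·, fᵢ), the second fundamental form paired with oᵢ is minus the
symmetrization of ∇β in its first two arguments, with fᵢ in the third. Proportionality to the metric
means equal diagonal entries up to ε and no off-diagonal entry. -/
lemma isUmbilicalAt_iff {β : E4 → E4 [⋀^Fin 2]→L[ℝ] ℝ} (hβ : ContDiffAt ℝ ∞ β S.y₀)
    {d₀ d₁ o₀ o₁ f₀ f₁ : E4} {ε : ℝ} (hε : ε * ε = 1)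
    (hf₀ : ∀ x, S.G S.y₀ x o₀ = β S.y₀ ![x, f₀]) (hf₁ : ∀ x, S.G S.y₀ x o₁ = β S.y₀ ![x, f₁])
    (h00 : S.G S.y₀ d₀ d₀ = ε) (h11 : S.G S.y₀ d₁ d₁ = 1) (h01 : S.G S.y₀ d₀ d₁ = 0)
    (hn : ∀ a c : ℝ, ∃ n, S.G S.y₀ n o₀ = a ∧ S.G S.y₀ n o₁ = c)
    (hD : ∀ x ∈ formKer (β S.y₀), ∃ a c : ℝ, x = a • d₀ + c • d₁)
    (hO : ∀ z, (∀ w ∈ formKer (β S.y₀), S.G S.y₀ z w = 0) → ∃ a c : ℝ, z = a • o₀ + c • o₁)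
    (hO₀ : ∀ w ∈ formKer (β S.y₀), S.G S.y₀ o₀ w = 0)
    (hO₁ : ∀ w ∈ formKer (β S.y₀), S.G S.y₀ o₁ w = 0)
    (hX₀ : ∃ X : E4 → E4, ContDiffAt ℝ ∞ X S.y₀ ∧ (∀ᶠ y in nhds S.y₀, X y ∈ formKer (β y)) ∧
      X S.y₀ = d₀)
    (hX₁ : ∃ X : E4 → E4, ContDiffAt ℝ ∞ X S.y₀ ∧ (∀ᶠ y in nhds S.y₀, X y ∈ formKer (β y)) ∧
      X S.y₀ = d₁) :
    S.IsUmbilicalAt (fun y => formKer (β y)) ↔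
      (ε * S.cov β d₀ d₀ f₀ = S.cov β d₁ d₁ f₀ ∧ S.cov β d₀ d₁ f₀ + S.cov β d₁ d₀ f₀ = 0) ∧
      (ε * S.cov β d₀ d₀ f₁ = S.cov β d₁ d₁ f₁ ∧ S.cov β d₀ d₁ f₁ + S.cov β d₁ d₀ f₁ = 0) := by
  have key : ∀ {X Y : E4 → E4}, ContDiffAt ℝ ∞ X S.y₀ → ContDiffAt ℝ ∞ Y S.y₀ →
    (∀ᶠ y in nhds S.y₀, X y ∈ formKer (β y)) → (∀ᶠ y in nhds S.y₀, Y y ∈ formKer (β y)) →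
    ∀ {o f}, (∀ x, S.G S.y₀ x o = β S.y₀ ![x, f]) →
      S.G S.y₀ (S.covVec Y (X S.y₀) + S.covVec X (Y S.y₀)) o =
        -(S.cov β (X S.y₀) (Y S.y₀) f + S.cov β (Y S.y₀) (X S.y₀) f) := by
    intro X Y hX hY hXD hYD o f hf
    rw [hf, alt_cons_add, cov_of_kernel hβ hX hXD, cov_of_kernel hβ hY hYD]
    ring
  constructor
  · rintro ⟨n, hn⟩
    obtain ⟨X₀, s₀, D₀, e₀⟩ := hX₀
    obtain ⟨X₁, s₁, D₁, e₁⟩ := hX₁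
    have aux : ∀ {o f}, (∀ x, S.G S.y₀ x o = β S.y₀ ![x, f]) →
        (∀ w ∈ formKer (β S.y₀), S.G S.y₀ o w = 0) →
        ε * S.cov β d₀ d₀ f = S.cov β d₁ d₁ f ∧ S.cov β d₀ d₁ f + S.cov β d₁ d₀ f = 0 := by
      intro o f hf ho
      have a := hn X₀ X₀ s₀ s₀ D₀ D₀ o ho
      have b := hn X₁ X₁ s₁ s₁ D₁ D₁ o ho
      have c := hn X₀ X₁ s₀ s₁ D₀ D₁ o ho
      rw [key s₀ s₀ D₀ D₀ hf, e₀, h00] at a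
      rw [key s₁ s₁ D₁ D₁ hf, e₁, h11] at b
      rw [key s₀ s₁ D₀ D₁ hf, e₀, e₁, h01] at c
      constructor
      · linear_combination (-ε) * a + b - S.G S.y₀ n o * hε
      · linear_combination (-2) * c
    exact ⟨aux hf₀ hO₀, aux hf₁ hO₁⟩
  · rintro ⟨⟨a0, a1⟩, ⟨b0, b1⟩⟩
    -- Since g(d₁, d₁) = 1, the vector n must be the value of the second fundamental form at (d₁,
    -- d₁).
    obtain ⟨n, hn₀, hn₁⟩ := hn (-(S.cov β d₁ d₁ f₀)) (-(S.cov β d₁ d₁ f₁))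
    refine ⟨n, fun X Y hX hY hXD hYD z hz => ?_⟩
    have aux : ∀ {o f}, (∀ x, S.G S.y₀ x o = β S.y₀ ![x, f]) →
        ε * S.cov β d₀ d₀ f = S.cov β d₁ d₁ f → S.cov β d₀ d₁ f + S.cov β d₁ d₀ f = 0 →
        S.G S.y₀ n o = -(S.cov β d₁ d₁ f) →
        (1 / 2 : ℝ) * S.G S.y₀ (S.covVec Y (X S.y₀) + S.covVec X (Y S.y₀)) o
        = S.G S.y₀ (X S.y₀) (Y S.y₀) * S.G S.y₀ n o := by
      intro o f hf i0 i1 i2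
      rw [key hX hY hXD hYD hf, i2]
      obtain ⟨x0, x1, hx⟩ := hD _ hXD.self_of_nhds
      obtain ⟨y0, y1, hy⟩ := hD _ hYD.self_of_nhds
      have h10 : S.G S.y₀ d₁ d₀ = 0 := by rw [S.symm, h01]
      have i3 : S.cov β d₀ d₀ f = ε * S.cov β d₁ d₁ f := by
        linear_combination ε * i0 - S.cov β d₀ d₀ f * hε
      rw [hx, hy]
      simp only [cov_add_left, cov_smul_left, cov_add_mid hβ, cov_smul_mid hβ, map_add, map_smul,
        add_apply, smul_apply, smul_eq_mul, h00, h01, h11, h10]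
      linear_combination (-(x0 * y0)) * i3 - (1 / 2) * (x0 * y1 + x1 * y0) * i1
    obtain ⟨z0, z1, rfl⟩ := hO z hz
    have r0 := aux hf₀ a0 a1 hn₀
    have r1 := aux hf₁ b0 b1 hn₁
    simp only [map_add, map_smul, add_apply, smul_eq_mul] at r0 r1 ⊢
    linear_combination z0 * r0 + z1 * r1

section Planes

variable {U : E4 → E4 [⋀^Fin 2]→L[ℝ] ℝ} {b : Fin 4 → E4}

lemma eventually_isAdapted (hU : ∀ᶠ y in nhds S.y₀, IsUnitary (S.G y) (U y)) :
    ∀ᶠ y in nhds S.y₀, ∃ b, IsAdapted (S.G y) (S.η y) (U y) b := by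
  filter_upwards [hU, S.frame] with y h1 h2
  obtain ⟨b, hb⟩ := h2
  exact exists_isAdapted hb (S.symm y) (S.vol_sq y) h1

lemma isUmbilicalAt_space_iff (hs : ContDiffAt ℝ ∞ U S.y₀)
    (hU : ∀ᶠ y in nhds S.y₀, IsUnitary (S.G y) (U y))
    (hb : IsAdapted (S.G S.y₀) (S.η S.y₀) (U S.y₀) b) :
    S.IsUmbilicalAt (fun y => formKer (U y)) ↔
      (S.cov U (b 2) (b 2) (b 1) = S.cov U (b 3) (b 3) (b 1) ∧
        S.cov U (b 2) (b 3) (b 1) + S.cov U (b 3) (b 2) (b 1) = 0) ∧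
      (S.cov U (b 2) (b 2) (b 0) = S.cov U (b 3) (b 3) (b 0) ∧
        S.cov U (b 2) (b 3) (b 0) + S.cov U (b 3) (b 2) (b 0) = 0) := by
  obtain ⟨h0, h1, h2, h3, h⟩ := hb.metric_frame
  have hext : ∀ v x, (∀ w, S.G S.y₀ x w = S.star U S.y₀ ![v, w]) →
      ∃ X : E4 → E4, ContDiffAt ℝ ∞ X S.y₀ ∧ (∀ᶠ y in nhds S.y₀, X y ∈ formKer (U y)) ∧
      X S.y₀ = x := by
    intro v x hx
    refine ⟨fun y => sharp (S.G y) (S.star U y) v, smooth_sharp (S.smooth_star hs) v, ?_, ?_⟩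
    · filter_upwards [eventually_isAdapted hU] with y hy
      obtain ⟨c, hc⟩ := hy
      exact hc.sharp_star_mem v
    · refine hb.ext_metric fun w => ?_
      rw [metric_sharp hb.frame hb.symm, hx]
  have := isUmbilicalAt_iff (S := S) (β := U) hs (d₀ := b 2) (d₁ := b 3) (o₀ := b 0) (o₁ := b 1)
    (f₀ := b 1) (f₁ := b 0) (ε := 1) (by norm_num)
    -- U(x, b₁) = g(b₀, x) and U(x, b₀) = g(b₁, x), which dictates the choice of f₀ and f₁.
    (fun x => by rw [hb.form, h1, h 0 1 (by decide), hb.symm x]; ring)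
    (fun x => by rw [hb.form, h0, h 1 0 (by decide), hb.symm x]; ring)
    h2 h3 (h 2 3 (by decide))
    (fun a c => ⟨(-a) • b 0 + c • b 1, by
      simp [h0, h1, h 0 1 (by decide), h 1 0 (by decide)]⟩)
    (fun x hx => ⟨_, _, by
      obtain ⟨e0, e1⟩ := (hb.mem_formKer x).mp hx
      conv_lhs => rw [hb.expand_four x, e0, e1, neg_zero, zero_smul, zero_smul, zero_add,
        zero_add]⟩)
    (fun z hz => ⟨_, _, by
      obtain ⟨e0, e1⟩ := (hb.mem_formKer_star z).mp ((hb.mem_formKer_star_iff z).mpr hz)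
      conv_lhs => rw [hb.expand_four z, e0, e1, zero_smul, zero_smul, add_zero, add_zero]⟩)
    (fun w hw => ((hb.mem_formKer w).mp hw).1) (fun w hw => ((hb.mem_formKer w).mp hw).2)
    (hext (-b 3) (b 2) fun w => by
      rw [star, hb.hodge2_form, map_neg, map_neg, h3, h 2 3 (by decide)]; ring)
    (hext (b 2) (b 3) fun w => by
      rw [star, hb.hodge2_form, h2, h 3 2 (by decide)]; ring)
  simpa only [one_mul] using this

lemma isUmbilicalAt_time_iff (hs : ContDiffAt ℝ ∞ U S.y₀)
    (hU : ∀ᶠ y in nhds S.y₀, IsUnitary (S.G y) (U y))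
    (hb : IsAdapted (S.G S.y₀) (S.η S.y₀) (U S.y₀) b) :
    S.IsUmbilicalAt (fun y => formKer (S.star U y)) ↔
      (-S.cov (S.star U) (b 0) (b 0) (b 3) = S.cov (S.star U) (b 1) (b 1) (b 3) ∧
        S.cov (S.star U) (b 0) (b 1) (b 3) + S.cov (S.star U) (b 1) (b 0) (b 3) = 0) ∧
      (-S.cov (S.star U) (b 0) (b 0) (b 2) = S.cov (S.star U) (b 1) (b 1) (b 2) ∧
        S.cov (S.star U) (b 0) (b 1) (b 2) + S.cov (S.star U) (b 1) (b 0) (b 2) = 0) := by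
  obtain ⟨h0, h1, h2, h3, h⟩ := hb.metric_frame
  have hext : ∀ v x, (∀ w, S.G S.y₀ x w = U S.y₀ ![v, w]) →
      ∃ X : E4 → E4, ContDiffAt ℝ ∞ X S.y₀ ∧ (∀ᶠ y in nhds S.y₀, X y ∈ formKer (S.star U y)) ∧
      X S.y₀ = x := by
    intro v x hx
    refine ⟨fun y => sharp (S.G y) (U y) v, smooth_sharp hs v, ?_, ?_⟩
    · filter_upwards [eventually_isAdapted hU] with y hy
      obtain ⟨c, hc⟩ := hy
      exact hc.sharp_mem v
    · refine hb.ext_metric fun w => ?_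
      rw [metric_sharp hb.frame hb.symm, hx]
  have hstar : S.star U S.y₀ = hodge2 (S.G S.y₀) (S.η S.y₀) (U S.y₀) := rfl
  have := isUmbilicalAt_iff (S := S) (β := S.star U) (S.smooth_star hs)
    -- *U(x, b₂) = -g(b₃, x) forces the sign of o₁; ε = -1 because b₀ is time-like.
    (d₀ := b 0) (d₁ := b 1) (o₀ := b 2) (o₁ := -b 3) (f₀ := b 3) (f₁ := b 2) (ε := -1) (by norm_num)
    (fun x => by rw [hstar, hb.hodge2_form, h3, h 2 3 (by decide), hb.symm x]; ring)
    (fun x => by rw [hstar, hb.hodge2_form, h2, h 3 2 (by decide), hb.symm x, map_neg, neg_apply]; ring)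
    h0 h1 (h 0 1 (by decide))
    (fun a c => ⟨a • b 2 + (-c) • b 3, by
      simp [h2, h3, h 2 3 (by decide), h 3 2 (by decide)]⟩)
    (fun x hx => ⟨_, _, by
      obtain ⟨e0, e1⟩ := (hb.mem_formKer_star x).mp hx
      conv_lhs => rw [hb.expand_four x, e0, e1, zero_smul, zero_smul, add_zero, add_zero]⟩)
    (fun z hz => ⟨S.G S.y₀ (b 2) z, -(S.G S.y₀ (b 3) z), by
      obtain ⟨e0, e1⟩ := (hb.mem_formKer z).mp ((hb.mem_formKer_iff z).mpr hz)
      conv_lhs => rw [hb.expand_four z, e0, e1, neg_zero, zero_smul, zero_smul, zero_add,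
        zero_add]
      rw [smul_neg, neg_smul, neg_neg]⟩)
    (fun w hw => ((hb.mem_formKer_star w).mp hw).1)
    (fun w hw => by rw [map_neg, neg_apply, ((hb.mem_formKer_star w).mp hw).2, neg_zero])
    (hext (-b 1) (b 0) fun w => by
      rw [hb.form, map_neg, map_neg, h1, h 0 1 (by decide)]; ring)
    (hext (-b 0) (b 1) fun w => by
      rw [hb.form, map_neg, map_neg, h0, h 1 0 (by decide)]; ring)
  simpa only [neg_mul, one_mul] using this

end Planes

end LocalSpacetime
/-! ## The component equations -/

/-- The Killing-Yano equation in components. -/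
lemma killing_components {N : Fin 4 → Fin 4 → Fin 4 → ℝ} (hN : ∀ i k l, N i k l = -N i l k) :
    (∀ i j k, N i j k + N j i k = 0) ↔
      (N 0 0 1 = 0 ∧ N 1 0 1 = 0 ∧ N 2 2 3 = 0 ∧ N 3 2 3 = 0) ∧
      (N 0 0 2 = 0 ∧ N 2 0 2 = 0 ∧ N 0 0 3 = 0 ∧ N 3 0 3 = 0) ∧
      (N 1 1 2 = 0 ∧ N 2 1 2 = 0 ∧ N 1 1 3 = 0 ∧ N 3 1 3 = 0) ∧
      (N 0 1 2 = N 2 0 1 ∧ N 1 0 2 = -N 2 0 1) ∧ (N 0 1 3 = N 3 0 1 ∧ N 1 0 3 = -N 3 0 1) ∧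
      (N 2 0 3 = -N 0 2 3 ∧ N 3 0 2 = N 0 2 3) ∧ (N 2 1 3 = -N 1 2 3 ∧ N 3 1 2 = N 1 2 3) := by
  have d : ∀ i k, N i k k = 0 := fun i k => by linarith [hN i k k]
  have s10 := fun i => hN i 1 0
  have s20 := fun i => hN i 2 0
  have s30 := fun i => hN i 3 0
  have s21 := fun i => hN i 2 1
  have s31 := fun i => hN i 3 1
  have s32 := fun i => hN i 3 2
  constructor
  · intro h
    have a := fun i k => h i i k
    refine ⟨⟨?_, ?_, ?_, ?_⟩, ⟨?_, ?_, ?_, ?_⟩, ⟨?_, ?_, ?_, ?_⟩, ⟨?_, ?_⟩, ⟨?_, ?_⟩, ⟨?_, ?_⟩, ?_, ?_⟩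
    · linarith [a 0 1]
    · linarith [a 1 0, s10 1]
    · linarith [a 2 3]
    · linarith [a 3 2, s32 3]
    · linarith [a 0 2]
    · linarith [a 2 0, s20 2]
    · linarith [a 0 3]
    · linarith [a 3 0, s30 3]
    · linarith [a 1 2]
    · linarith [a 2 1, s21 2]
    · linarith [a 1 3]
    · linarith [a 3 1, s31 3]
    · linarith [h 0 2 1, s21 0]
    · linarith [h 1 2 0, s20 1, s10 2]
    · linarith [h 0 3 1, s31 0]
    · linarith [h 1 3 0, s30 1, s10 3]
    · linarith [h 0 2 3]
    · linarith [h 0 3 2, s32 0]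
    · linarith [h 1 2 3]
    · linarith [h 1 3 2, s32 1]
  · rintro ⟨⟨a1, a2, a3, a4⟩, ⟨b1, b2, b3, b4⟩, ⟨c1, c2, c3, c4⟩, ⟨e1, e2⟩, ⟨e3, e4⟩, ⟨e5, e6⟩,
      e7, e8⟩ i j k
    fin_cases i <;> fin_cases j <;> fin_cases k <;>
      simp only [Fin.zero_eta, Fin.mk_one, Fin.reduceFinMk, d, s10, s20, s30, s21, s31, s32, a1, a2,
        a3, a4, b1, b2, b3, b4, c1, c2, c3, c4, e1, e2, e3, e4, e5, e6, e7, e8, neg_zero, add_zero,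
        neg_neg, neg_add_cancel, add_neg_cancel]

lemma rotation_eq_zero {c s a b : ℝ} (h : c ^ 2 + s ^ 2 = 1) :
    (c * a + s * b = 0 ∧ s * a - c * b = 0) ↔ a = 0 ∧ b = 0 := by
  constructor
  · rintro ⟨h1, h2⟩
    constructor
    · linear_combination c * h1 + s * h2 - a * h
    · linear_combination s * h1 - c * h2 - b * h
  · rintro ⟨rfl, rfl⟩; simp

/-- The components `(012), (013), (023), (123)` of the exterior derivative of `p U + q *U`; here
`a₂, a₃, e₂, e₃` are the components `02, 03, 12, 13` of `∇U`. -/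
def ClosedEq (p q : ℝ) (dp dq a₂ a₃ e₂ e₃ : Fin 4 → ℝ) : Prop :=
  ((p * e₂ 0 - q * a₃ 0) - (p * a₂ 1 - q * e₃ 1) - dp 2 = 0 ∧
    (p * e₃ 0 + q * a₂ 0) - (p * a₃ 1 + q * e₂ 1) - dp 3 = 0) ∧
  (dq 0 - (p * a₃ 2 + q * e₂ 2) + (p * a₂ 3 - q * e₃ 3) = 0 ∧
    dq 1 - (p * e₃ 2 + q * a₂ 2) + (p * e₂ 3 - q * a₃ 3) = 0)

/-- The Killing-Yano equation for `p U + q *U` in components. -/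
def KillingEq (p q : ℝ) (dp dq a₂ a₃ e₂ e₃ : Fin 4 → ℝ) : Prop :=
  (-dp 0 = 0 ∧ -dp 1 = 0 ∧ dq 2 = 0 ∧ dq 3 = 0) ∧
  (p * a₂ 0 - q * e₃ 0 = 0 ∧ p * a₂ 2 - q * e₃ 2 = 0 ∧
    p * a₃ 0 + q * e₂ 0 = 0 ∧ p * a₃ 3 + q * e₂ 3 = 0) ∧
  (p * e₂ 1 - q * a₃ 1 = 0 ∧ p * e₂ 2 - q * a₃ 2 = 0 ∧
    p * e₃ 1 + q * a₂ 1 = 0 ∧ p * e₃ 3 + q * a₂ 3 = 0) ∧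
  (p * e₂ 0 - q * a₃ 0 = -dp 2 ∧ p * a₂ 1 - q * e₃ 1 = -(-dp 2)) ∧
  (p * e₃ 0 + q * a₂ 0 = -dp 3 ∧ p * a₃ 1 + q * e₂ 1 = -(-dp 3)) ∧
  (p * a₃ 2 + q * e₂ 2 = -dq 0 ∧ p * a₂ 3 - q * e₃ 3 = dq 0) ∧
  (p * e₃ 2 + q * a₂ 2 = -dq 1 ∧ p * e₂ 3 - q * a₃ 3 = dq 1)

/-- Umbilicity in components. -/
def UmbilicalEq (a₂ a₃ e₂ e₃ : Fin 4 → ℝ) : Prop :=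
  ((a₂ 2 - a₃ 3 = 0 ∧ e₃ 2 + e₂ 3 = 0) ∧ (e₂ 2 - e₃ 3 = 0 ∧ a₃ 2 + a₂ 3 = 0)) ∧
  ((a₂ 0 + e₂ 1 = 0 ∧ e₃ 0 + a₃ 1 = 0) ∧ (e₂ 0 + a₂ 1 = 0 ∧ a₃ 0 + e₃ 1 = 0))

/-- The core of the theorem, at angle zero; both sides are twenty linear equations. From right to
left, the last block and the second Maxwell block together give x₀ = x₁ = y₂ = y₃ = 0. The last
block also makes the traces vanish, so umbilicity kills the diagonal terms. The first Maxwell block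
and the remaining umbilicity equations give differences and sums of the same pairs, which fixes each
member. -/
lemma killing_iff_rotated (x y n₂ n₃ m₂ m₃ : Fin 4 → ℝ) :
    KillingEq 1 0 x y n₂ n₃ m₂ m₃ ↔
      (ClosedEq 1 0 (fun i => -2 * x i) (fun i => -2 * y i) n₂ n₃ m₂ m₃ ∧
        ClosedEq 0 1 (fun i => 2 * y i) (fun i => -2 * x i) n₂ n₃ m₂ m₃) ∧
      UmbilicalEq n₂ n₃ m₂ m₃ ∧ ClosedEq 0 1 0 0 n₂ n₃ m₂ m₃ := by
  simp only [KillingEq, ClosedEq, UmbilicalEq, one_mul, zero_mul, sub_zero, add_zero, zero_sub,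
    zero_add, Pi.zero_apply]
  constructor
  · rintro ⟨⟨a1, a2, a3, a4⟩, ⟨b1, b2, b3, b4⟩, ⟨c1, c2, c3, c4⟩, ⟨e1, e2⟩, ⟨e3, e4⟩, ⟨e5, e6⟩,
      e7, e8⟩
    simp only [and_assoc]
    refine ⟨?_, ?_, ?_, ?_, ?_, ?_, ?_, ?_, ?_, ?_, ?_, ?_, ?_, ?_, ?_, ?_, ?_, ?_, ?_, ?_⟩ <;>
      linarith
  · rintro ⟨⟨⟨⟨a1, a2⟩, a3, a4⟩, ⟨b1, b2⟩, b3, b4⟩, ⟨⟨⟨c1, c2⟩, c3, c4⟩, ⟨c5, c6⟩, c7, c8⟩,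
      ⟨e1, e2⟩, e3, e4⟩
    simp only [and_assoc]
    refine ⟨?_, ?_, ?_, ?_, ?_, ?_, ?_, ?_, ?_, ?_, ?_, ?_, ?_, ?_, ?_, ?_, ?_, ?_, ?_, ?_⟩ <;>
      linarith

/-- Component by component, one pair of closedness equations is K times an orthogonal
transformation, with entries ±r and ±t, of the other pair; hence they vanish together. -/
lemma closed_pair {p q p' q' r t : ℝ} {dp dq dp' dq' a₂ a₃ e₂ e₃ u₂ u₃ w₂ w₃ d1 d2 : Fin 4 → ℝ}
    (h : r ^ 2 + t ^ 2 = 1) {K : ℝ} (hK : K ≠ 0)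
    (hdp : ∀ i, dp i = K * (r * d2 i + t * d1 i)) (hdp' : ∀ i, dp' i = K * (t * d2 i - r * d1 i))
    (hdq : ∀ i, dq i = K * (r * d1 i - t * d2 i)) (hdq' : ∀ i, dq' i = K * (t * d1 i + r * d2 i))
    (h1 : ∀ i, p * e₂ i - q * a₃ i = K * (t * w₂ i - r * u₃ i))
    (h2 : ∀ i, p * a₂ i - q * e₃ i = K * (t * u₂ i - r * w₃ i))
    (h3 : ∀ i, p * e₃ i + q * a₂ i = K * (t * w₃ i + r * u₂ i))
    (h4 : ∀ i, p * a₃ i + q * e₂ i = K * (t * u₃ i + r * w₂ i))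
    (h1' : ∀ i, p' * e₂ i - q' * a₃ i = -K * (r * w₂ i + t * u₃ i))
    (h2' : ∀ i, p' * a₂ i - q' * e₃ i = -K * (r * u₂ i + t * w₃ i))
    (h3' : ∀ i, p' * e₃ i + q' * a₂ i = -K * (r * w₃ i - t * u₂ i))
    (h4' : ∀ i, p' * a₃ i + q' * e₂ i = -K * (r * u₃ i - t * w₂ i)) :
    (ClosedEq p q dp dq a₂ a₃ e₂ e₃ ∧ ClosedEq p' q' dp' dq' a₂ a₃ e₂ e₃) ↔
      (ClosedEq 1 0 d1 (-d2) u₂ u₃ w₂ w₃ ∧ ClosedEq 0 1 d2 d1 u₂ u₃ w₂ w₃) := by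
  have rot : ∀ {X Y X' Y' : ℝ}, X = K * (r * Y + t * X') → Y' = K * (t * Y - r * X') →
      ((X = 0 ∧ Y' = 0) ↔ (X' = 0 ∧ Y = 0)) := by
    rintro X Y X' Y' rfl rfl
    simp only [mul_eq_zero, hK, false_or]
    rw [rotation_eq_zero h, and_comm]
  simp only [ClosedEq, hdp, hdp', hdq, hdq', h1, h2, h3, h4, h1', h2', h3', h4', Pi.neg_apply,
    one_mul, zero_mul, sub_zero, add_zero, zero_sub, zero_add]
  have r1 := rot (X := K * (t * w₂ 0 - r * u₃ 0) - K * (t * u₂ 1 - r * w₃ 1) -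
      K * (r * d2 2 + t * d1 2)) (X' := w₂ 0 - u₂ 1 - d1 2) (Y := -u₃ 0 - -w₃ 1 - d2 2)
    (Y' := -K * (r * w₂ 0 + t * u₃ 0) - -K * (r * u₂ 1 + t * w₃ 1) - K * (t * d2 2 - r * d1 2))
    (by ring) (by ring)
  have r2 := rot (X := K * (t * w₃ 0 + r * u₂ 0) - K * (t * u₃ 1 + r * w₂ 1) -
      K * (r * d2 3 + t * d1 3)) (X' := w₃ 0 - u₃ 1 - d1 3) (Y := u₂ 0 - w₂ 1 - d2 3)
    (Y' := -K * (r * w₃ 0 - t * u₂ 0) - -K * (r * u₃ 1 - t * w₂ 1) - K * (t * d2 3 - r * d1 3))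
    (by ring) (by ring)
  have r3 := rot (X := K * (r * d1 0 - t * d2 0) - K * (t * u₃ 2 + r * w₂ 2) +
      K * (t * u₂ 3 - r * w₃ 3)) (X' := -d2 0 - u₃ 2 + u₂ 3) (Y := d1 0 - w₂ 2 + -w₃ 3)
    (Y' := K * (t * d1 0 + r * d2 0) - -K * (r * u₃ 2 - t * w₂ 2) + -K * (r * u₂ 3 + t * w₃ 3))
    (by ring) (by ring)
  have r4 := rot (X := K * (r * d1 1 - t * d2 1) - K * (t * w₃ 2 + r * u₂ 2) +
      K * (t * w₂ 3 - r * u₃ 3)) (X' := -d2 1 - w₃ 2 + w₂ 3) (Y := d1 1 - u₂ 2 + -u₃ 3)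
    (Y' := K * (t * d1 1 + r * d2 1) - -K * (r * w₃ 2 - t * u₂ 2) + -K * (r * w₂ 3 + t * u₃ 3))
    (by ring) (by ring)
  constructor
  · rintro ⟨⟨⟨x1, x2⟩, x3, x4⟩, ⟨y1, y2⟩, y3, y4⟩
    have z1 := r1.mp ⟨x1, y1⟩
    have z2 := r2.mp ⟨x2, y2⟩
    have z3 := r3.mp ⟨x3, y3⟩
    have z4 := r4.mp ⟨x4, y4⟩
    exact ⟨⟨⟨z1.1, z2.1⟩, z3.1, z4.1⟩, ⟨z1.2, z2.2⟩, z3.2, z4.2⟩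
  · rintro ⟨⟨⟨x1, x2⟩, x3, x4⟩, ⟨y1, y2⟩, y3, y4⟩
    have z1 := r1.mpr ⟨x1, y1⟩
    have z2 := r2.mpr ⟨x2, y2⟩
    have z3 := r3.mpr ⟨x3, y3⟩
    have z4 := r4.mpr ⟨x4, y4⟩
    exact ⟨⟨⟨z1.1, z2.1⟩, z3.1, z4.1⟩, ⟨z1.2, z2.2⟩, z3.2, z4.2⟩

/-- The common factor E, to be exp φ, divides out, and the angle is absorbed into the new
components. -/
lemma killing_scale {p q E : ℝ} (hE : E ≠ 0) {dp dq x y a₂ a₃ e₂ e₃ n₂ n₃ m₂ m₃ : Fin 4 → ℝ}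
    (hp : ∀ i, dp i = E * x i) (hq : ∀ i, dq i = E * y i)
    (h1 : ∀ i, p * e₂ i - q * a₃ i = E * m₂ i) (h2 : ∀ i, p * a₂ i - q * e₃ i = E * n₂ i)
    (h3 : ∀ i, p * e₃ i + q * a₂ i = E * m₃ i) (h4 : ∀ i, p * a₃ i + q * e₂ i = E * n₃ i) :
    KillingEq p q dp dq a₂ a₃ e₂ e₃ ↔ KillingEq 1 0 x y n₂ n₃ m₂ m₃ := by
  simp only [KillingEq, hp, hq, h1, h2, h3, h4, ← mul_neg, mul_eq_zero, hE, false_or,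
    mul_right_inj' hE, one_mul, zero_mul, sub_zero, add_zero]

/-- Umbilicity belongs to the planes and not to the angle: each of its four pairs of equations is
rotated into itself. -/
lemma umbilical_rotate {c s : ℝ} (h : c ^ 2 + s ^ 2 = 1) {a₂ a₃ e₂ e₃ n₂ n₃ m₂ m₃ : Fin 4 → ℝ}
    (h1 : ∀ i, m₂ i = c * e₂ i - s * a₃ i) (h2 : ∀ i, n₂ i = c * a₂ i - s * e₃ i)
    (h3 : ∀ i, m₃ i = c * e₃ i + s * a₂ i) (h4 : ∀ i, n₃ i = c * a₃ i + s * e₂ i) :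
    UmbilicalEq a₂ a₃ e₂ e₃ ↔ UmbilicalEq n₂ n₃ m₂ m₃ := by
  have rot : ∀ {A B P Q : ℝ}, P = c * A - s * B → Q = s * A + c * B →
      ((A = 0 ∧ B = 0) ↔ (P = 0 ∧ Q = 0)) := by
    rintro A B P Q rfl rfl
    constructor
    · rintro ⟨rfl, rfl⟩; simp
    · rintro ⟨i1, i2⟩
      constructor
      · linear_combination c * i1 + s * i2 - A * h
      · linear_combination c * i2 - s * i1 - B * h
  simp only [UmbilicalEq]
  refine and_congr (and_congr (rot ?_ ?_) (rot ?_ ?_)) (and_congr (rot ?_ ?_) (rot ?_ ?_)) <;>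
    simp only [h1, h2, h3, h4] <;> ring

/-- The equivalence in components. -/
lemma killing_iff {c s E K : ℝ} (h : c ^ 2 + s ^ 2 = 1) (hE : E ≠ 0) (hK : K ≠ 0)
    (f g a₂ a₃ e₂ e₃ : Fin 4 → ℝ) :
    KillingEq (E * c) (E * s) (fun i => E * (c * f i - s * g i)) (fun i => E * (s * f i + c * g i))
        a₂ a₃ e₂ e₃ ↔
      (ClosedEq (K * (2 * s * c)) (K * (c ^ 2 - s ^ 2))
          (fun i => K * (-2 * f i * (2 * s * c) + 2 * g i * (c ^ 2 - s ^ 2)))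
          (fun i => K * (-2 * f i * (c ^ 2 - s ^ 2) - 2 * g i * (2 * s * c))) a₂ a₃ e₂ e₃ ∧
        ClosedEq (-(K * (c ^ 2 - s ^ 2))) (K * (2 * s * c))
          (fun i => K * (2 * f i * (c ^ 2 - s ^ 2) + 2 * g i * (2 * s * c)))
          (fun i => K * (-2 * f i * (2 * s * c) + 2 * g i * (c ^ 2 - s ^ 2))) a₂ a₃ e₂ e₃) ∧
      UmbilicalEq a₂ a₃ e₂ e₃ ∧ ClosedEq (-s) c 0 0 a₂ a₃ e₂ e₃ := by
  -- For c = cos ψ and s = sin ψ these are cos 3ψ and sin 3ψ, the coefficients of the rotation in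
  -- `closed_pair`.
  have hrt : (c * (c ^ 2 - s ^ 2) - s * (2 * s * c)) ^ 2 +
      (c * (2 * s * c) + s * (c ^ 2 - s ^ 2)) ^ 2 = 1 := by
    have : (c * (c ^ 2 - s ^ 2) - s * (2 * s * c)) ^ 2 +
      (c * (2 * s * c) + s * (c ^ 2 - s ^ 2)) ^ 2 = (c ^ 2 + s ^ 2) ^ 3 := by ring
    rw [this, h]; norm_num
  rw [killing_scale hE (x := fun i => c * f i - s * g i) (y := fun i => s * f i + c * g i)
    (n₂ := fun i => c * a₂ i - s * e₃ i) (n₃ := fun i => c * a₃ i + s * e₂ i)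
    (m₂ := fun i => c * e₂ i - s * a₃ i) (m₃ := fun i => c * e₃ i + s * a₂ i)
    (fun i => rfl) (fun i => rfl) (fun i => by ring) (fun i => by ring) (fun i => by ring)
    (fun i => by ring), killing_iff_rotated]
  have hd : (fun i => -2 * (s * f i + c * g i)) = -(fun i => 2 * (s * f i + c * g i)) := by
    ext i; simp
  refine and_congr ?_ (and_congr ?_ ?_)
  · rw [hd]
    symm
    refine closed_pair hrt hK (fun i => ?_) (fun i => ?_) (fun i => ?_) (fun i => ?_)
      (fun i => ?_) (fun i => ?_) (fun i => ?_) (fun i => ?_) (fun i => ?_) (fun i => ?_)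
      (fun i => ?_) (fun i => ?_)
    · linear_combination (-(K * (-2 * f i * (2 * s * c) + 2 * g i * (c ^ 2 - s ^ 2)))) * h
    · linear_combination (-(K * (2 * f i * (c ^ 2 - s ^ 2) + 2 * g i * (2 * s * c)))) * h
    · linear_combination (-(K * (-2 * f i * (c ^ 2 - s ^ 2) - 2 * g i * (2 * s * c)))) * h
    · linear_combination (-(K * (-2 * f i * (2 * s * c) + 2 * g i * (c ^ 2 - s ^ 2)))) * h
    · linear_combination (-K * ((2 * s * c) * e₂ i - (c ^ 2 - s ^ 2) * a₃ i)) * h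
    · linear_combination (-K * ((2 * s * c) * a₂ i - (c ^ 2 - s ^ 2) * e₃ i)) * h
    · linear_combination (-K * ((2 * s * c) * e₃ i + (c ^ 2 - s ^ 2) * a₂ i)) * h
    · linear_combination (-K * ((2 * s * c) * a₃ i + (c ^ 2 - s ^ 2) * e₂ i)) * h
    · linear_combination (K * ((c ^ 2 - s ^ 2) * e₂ i + (2 * s * c) * a₃ i)) * h
    · linear_combination (K * ((c ^ 2 - s ^ 2) * a₂ i + (2 * s * c) * e₃ i)) * h
    · linear_combination (K * ((c ^ 2 - s ^ 2) * e₃ i - (2 * s * c) * a₂ i)) * h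
    · linear_combination (K * ((c ^ 2 - s ^ 2) * a₃ i - (2 * s * c) * e₂ i)) * h
  · exact (umbilical_rotate h (fun i => rfl) (fun i => rfl) (fun i => rfl) (fun i => rfl)).symm
  · simp only [ClosedEq, Pi.zero_apply]
    refine and_congr (and_congr ?_ ?_) (and_congr ?_ ?_) <;>
      exact Eq.congr (by ring) rfl

/-! ### The equations for p U + q *U in an adapted frame, and the theorem at a point. -/

namespace LocalSpacetime

variable {S : LocalSpacetime} {U : E4 → E4 [⋀^Fin 2]→L[ℝ] ℝ} {b : Fin 4 → E4}

/-- The 2-form `p U + q *U`. -/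
def comb (S : LocalSpacetime) (U : E4 → E4 [⋀^Fin 2]→L[ℝ] ℝ) (p q : E4 → ℝ) (y : E4) :
    E4 [⋀^Fin 2]→L[ℝ] ℝ := p y • U y + q y • S.star U y

section comb

variable {p q : E4 → ℝ}

/-- The derivatives of the coefficients occupy the components 01 and 23, and ∇U together with its
dual the other four. -/
lemma cov_comb (hs : ContDiffAt ℝ ∞ U S.y₀) (hU : ∀ᶠ y in nhds S.y₀, IsUnitary (S.G y) (U y))
    (hb : IsAdapted (S.G S.y₀) (S.η S.y₀) (U S.y₀) b)
    (hp : DifferentiableAt ℝ p S.y₀) (hq : DifferentiableAt ℝ q S.y₀) (i : Fin 4) :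
    S.cov (S.comb U p q) (b i) (b 0) (b 1) = -fderiv ℝ p S.y₀ (b i) ∧
    S.cov (S.comb U p q) (b i) (b 2) (b 3) = fderiv ℝ q S.y₀ (b i) ∧
    S.cov (S.comb U p q) (b i) (b 0) (b 2) =
      p S.y₀ * S.cov U (b i) (b 0) (b 2) - q S.y₀ * S.cov U (b i) (b 1) (b 3) ∧
    S.cov (S.comb U p q) (b i) (b 0) (b 3) =
      p S.y₀ * S.cov U (b i) (b 0) (b 3) + q S.y₀ * S.cov U (b i) (b 1) (b 2) ∧
    S.cov (S.comb U p q) (b i) (b 1) (b 2) =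
      p S.y₀ * S.cov U (b i) (b 1) (b 2) - q S.y₀ * S.cov U (b i) (b 0) (b 3) ∧
    S.cov (S.comb U p q) (b i) (b 1) (b 3) =
      p S.y₀ * S.cov U (b i) (b 1) (b 3) + q S.y₀ * S.cov U (b i) (b 0) (b 2) := by
  have hW := S.smooth_star hs
  obtain ⟨h0, h1, h2, h3, h⟩ := hb.metric_frame
  have anti : ∀ a c, S.cov U (b i) (b a) (b c) = -S.cov U (b i) (b c) (b a) :=
    fun a c => cov_swap hs _ _ _
  have hst : ∀ v w, S.star U S.y₀ ![v, w] = S.G S.y₀ (b 2) v * S.G S.y₀ (b 3) w -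
      S.G S.y₀ (b 2) w * S.G S.y₀ (b 3) v := hb.hodge2_form
  have hc : ∀ k l, S.cov (S.comb U p q) (b i) (b k) (b l) =
      fderiv ℝ p S.y₀ (b i) * U S.y₀ ![b k, b l] + p S.y₀ * S.cov U (b i) (b k) (b l) +
        (fderiv ℝ q S.y₀ (b i) * S.star U S.y₀ ![b k, b l] +
          q S.y₀ * dual (fun a c => S.cov U (b i) (b a) (b c)) k l) := fun k l => by
    rw [← cov_star hs hb.toIsOriented]
    exact cov_combination hs hW hp hq _ _ _
  simp only [hc, dual_01 anti, dual_02 anti, dual_03 anti, dual_12 anti, dual_13 anti,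
    dual_23 anti, hb.form_01, hb.form_02, hb.form_03, hb.form_12, hb.form_13, hb.form_23,
    cov_unitary_01 hs hU hb, cov_unitary_23 hs hU hb, hst, h2, h3, h 2 0 (by decide),
    h 2 1 (by decide), h 2 3 (by decide), h 3 0 (by decide), h 3 1 (by decide), h 3 2 (by decide)]
  refine ⟨?_, ?_, ?_, ?_, ?_, ?_⟩ <;> ring

lemma smooth_comb (hs : ContDiffAt ℝ ∞ U S.y₀) (hp : ContDiffAt ℝ ∞ p S.y₀)
    (hq : ContDiffAt ℝ ∞ q S.y₀) : ContDiffAt ℝ ∞ (S.comb U p q) S.y₀ :=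
  (hp.smul hs).add (hq.smul (S.smooth_star hs))

/-- `*d(pU + q*U) = 0` in components. -/
lemma hodge3_extDeriv_comb (hs : ContDiffAt ℝ ∞ U S.y₀)
    (hU : ∀ᶠ y in nhds S.y₀, IsUnitary (S.G y) (U y))
    (hb : IsAdapted (S.G S.y₀) (S.η S.y₀) (U S.y₀) b)
    (hp : DifferentiableAt ℝ p S.y₀) (hq : DifferentiableAt ℝ q S.y₀) :
    hodge3 (S.G S.y₀) (S.η S.y₀) (extDeriv (S.comb U p q) S.y₀) = 0 ↔
      ClosedEq (p S.y₀) (q S.y₀) (fun i => fderiv ℝ p S.y₀ (b i)) (fun i => fderiv ℝ q S.y₀ (b i))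
        (fun i => S.cov U (b i) (b 0) (b 2)) (fun i => S.cov U (b i) (b 0) (b 3))
        (fun i => S.cov U (b i) (b 1) (b 2)) (fun i => S.cov U (b i) (b 1) (b 3)) := by
  rw [hb.hodge3_eq_zero_iff]
  simp only [extDeriv_eq_cov, ClosedEq, and_assoc]
  obtain ⟨a1, a2, a3, a4, a5, a6⟩ := cov_comb hs hU hb hp hq 0
  obtain ⟨b1, b2, b3, b4, b5, b6⟩ := cov_comb hs hU hb hp hq 1
  obtain ⟨c1, c2, c3, c4, c5, c6⟩ := cov_comb hs hU hb hp hq 2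
  obtain ⟨d1, d2, d3, d4, d5, d6⟩ := cov_comb hs hU hb hp hq 3
  rw [a2, a5, a6, b2, b3, b4, c1, c4, c6, d1, d3, d5]
  simp only [sub_eq_add_neg]

lemma cov_add_right {β : E4 → E4 [⋀^Fin 2]→L[ℝ] ℝ} (hβ : ContDiffAt ℝ ∞ β S.y₀) (u v w w' : E4) :
    S.cov β u v (w + w') = S.cov β u v w + S.cov β u v w' := by
  simp only [← deriv_formT_apply hβ]; exact alt_cons_cons_add _ _ _ _ _

lemma cov_smul_right {β : E4 → E4 [⋀^Fin 2]→L[ℝ] ℝ} (hβ : ContDiffAt ℝ ∞ β S.y₀) (c : ℝ)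
    (u v w : E4) : S.cov β u v (c • w) = c * S.cov β u v w := by
  simp only [← deriv_formT_apply hβ]; exact alt_cons_cons_smul _ _ _ _ _

lemma eq_zero_of_frame {g : Bilin4} (hb : IsFrame g b) {f : E4 → ℝ}
    (hadd : ∀ x y, f (x + y) = f x + f y) (hsmul : ∀ (c : ℝ) x, f (c • x) = c * f x)
    (h : ∀ i, f (b i) = 0) (x : E4) : f x = 0 := by
  rw [hb.expand x]
  simp only [Fin.sum_univ_four, hadd, hsmul, h, mul_zero, add_zero]

/-- The Killing-Yano equation holds if it holds in a frame. -/
lemma killing_frame {g : Bilin4} (hb : IsFrame g b) {β : E4 → E4 [⋀^Fin 2]→L[ℝ] ℝ}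
    (hβ : ContDiffAt ℝ ∞ β S.y₀) :
    (∀ u v w, S.cov β u v w + S.cov β v u w = 0) ↔
      ∀ i j k, S.cov β (b i) (b j) (b k) + S.cov β (b j) (b i) (b k) = 0 := by
  refine ⟨fun h i j k => h _ _ _, fun h u v w => ?_⟩
  refine eq_zero_of_frame hb (f := fun w => S.cov β u v w + S.cov β v u w)
    (fun x y => by simp only [cov_add_right hβ]; ring)
    (fun c x => by simp only [cov_smul_right hβ]; ring) (fun k => ?_) w
  refine eq_zero_of_frame hb (f := fun v => S.cov β u v (b k) + S.cov β v u (b k))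
    (fun x y => by simp only [cov_add_mid hβ, cov_add_left]; ring)
    (fun c x => by simp only [cov_smul_mid hβ, cov_smul_left]; ring) (fun j => ?_) v
  exact eq_zero_of_frame hb (f := fun u => S.cov β u (b j) (b k) + S.cov β (b j) u (b k))
    (fun x y => by simp only [cov_add_mid hβ, cov_add_left]; ring)
    (fun c x => by simp only [cov_smul_mid hβ, cov_smul_left]; ring) (fun i => h i j k) u

/-- The Killing-Yano equation for `p U + q *U` in components. -/
lemma killing_comb (hs : ContDiffAt ℝ ∞ U S.y₀)
    (hU : ∀ᶠ y in nhds S.y₀, IsUnitary (S.G y) (U y))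
    (hb : IsAdapted (S.G S.y₀) (S.η S.y₀) (U S.y₀) b)
    (hp : ContDiffAt ℝ ∞ p S.y₀) (hq : ContDiffAt ℝ ∞ q S.y₀) :
    (∀ u v w, S.cov (S.comb U p q) u v w + S.cov (S.comb U p q) v u w = 0) ↔
      KillingEq (p S.y₀) (q S.y₀) (fun i => fderiv ℝ p S.y₀ (b i))
        (fun i => fderiv ℝ q S.y₀ (b i))
        (fun i => S.cov U (b i) (b 0) (b 2)) (fun i => S.cov U (b i) (b 0) (b 3))
        (fun i => S.cov U (b i) (b 1) (b 2)) (fun i => S.cov U (b i) (b 1) (b 3)) := by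
  have hc := smooth_comb hs hp hq
  rw [killing_frame hb.frame hc, killing_components
    (N := fun i k l => S.cov (S.comb U p q) (b i) (b k) (b l)) fun i k l => cov_swap hc _ _ _]
  have h := cov_comb hs hU hb (hp.differentiableAt (by simp)) (hq.differentiableAt (by simp))
  simp only [fun i => (h i).1, fun i => (h i).2.1, fun i => (h i).2.2.1, fun i => (h i).2.2.2.1,
    fun i => (h i).2.2.2.2.1, fun i => (h i).2.2.2.2.2, KillingEq]

end comb

lemma umbilical_iff (hs : ContDiffAt ℝ ∞ U S.y₀)
    (hU : ∀ᶠ y in nhds S.y₀, IsUnitary (S.G y) (U y))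
    (hb : IsAdapted (S.G S.y₀) (S.η S.y₀) (U S.y₀) b) :
    (S.IsUmbilicalAt (fun y => formKer (S.star U y)) ∧ S.IsUmbilicalAt (fun y => formKer (U y))) ↔
      UmbilicalEq (fun i => S.cov U (b i) (b 0) (b 2)) (fun i => S.cov U (b i) (b 0) (b 3))
        (fun i => S.cov U (b i) (b 1) (b 2)) (fun i => S.cov U (b i) (b 1) (b 3)) := by
  rw [isUmbilicalAt_time_iff hs hU hb, isUmbilicalAt_space_iff hs hU hb]
  have anti : ∀ i a c, S.cov U (b i) (b a) (b c) = -S.cov U (b i) (b c) (b a) :=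
    fun i a c => cov_swap hs _ _ _
  -- The time-like plane is the kernel of *U; parallelism of the dual expresses its equations
  -- through ∇U.
  simp only [cov_star hs hb.toIsOriented, dual_02 (anti _), dual_03 (anti _), dual_12 (anti _),
    dual_13 (anti _), UmbilicalEq]
  simp only [fun i => anti i 2 1, fun i => anti i 3 1, fun i => anti i 2 0, fun i => anti i 3 0]
  constructor
  · rintro ⟨⟨⟨a1, a2⟩, a3, a4⟩, ⟨b1, b2⟩, b3, b4⟩
    refine ⟨⟨⟨?_, ?_⟩, ?_, ?_⟩, ⟨?_, ?_⟩, ?_, ?_⟩ <;> linarith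
  · rintro ⟨⟨⟨a1, a2⟩, a3, a4⟩, ⟨b1, b2⟩, b3, b4⟩
    refine ⟨⟨⟨?_, ?_⟩, ?_, ?_⟩, ⟨?_, ?_⟩, ?_, ?_⟩ <;> linarith

/-- The theorem at a point, in a chart. -/
theorem killing_iff_maxwell (hs : ContDiffAt ℝ ∞ U S.y₀)
    (hU : ∀ᶠ y in nhds S.y₀, IsUnitary (S.G y) (U y)) {φ ψ : E4 → ℝ}
    (hφ : ContDiffAt ℝ ∞ φ S.y₀) (hψ : ContDiffAt ℝ ∞ ψ S.y₀) :
    (∀ u v w,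
        S.cov (S.comb U (fun y => Real.exp (φ y) * Real.cos (ψ y))
          (fun y => Real.exp (φ y) * Real.sin (ψ y))) u v w +
        S.cov (S.comb U (fun y => Real.exp (φ y) * Real.cos (ψ y))
          (fun y => Real.exp (φ y) * Real.sin (ψ y))) v u w = 0) ↔
      (hodge3 (S.G S.y₀) (S.η S.y₀) (extDeriv (S.comb U
          (fun y => Real.exp (-2 * φ y) * Real.sin (2 * ψ y))
          (fun y => Real.exp (-2 * φ y) * Real.cos (2 * ψ y))) S.y₀) = 0 ∧
        hodge3 (S.G S.y₀) (S.η S.y₀) (extDeriv (S.comb U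
          (fun y => -(Real.exp (-2 * φ y) * Real.cos (2 * ψ y)))
          (fun y => Real.exp (-2 * φ y) * Real.sin (2 * ψ y))) S.y₀) = 0) ∧
      (S.IsUmbilicalAt (fun y => formKer (S.star U y)) ∧
        S.IsUmbilicalAt (fun y => formKer (U y))) ∧
      hodge3 (S.G S.y₀) (S.η S.y₀) (extDeriv (S.comb U (fun _ => -Real.sin (ψ S.y₀))
          (fun _ => Real.cos (ψ S.y₀))) S.y₀) = 0 := by
  obtain ⟨b, hb⟩ := (eventually_isAdapted hU).self_of_nhds
  have dφ := (hφ.differentiableAt (by simp)).hasFDerivAt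
  have dψ := (hψ.differentiableAt (by simp)).hasFDerivAt
  have e1 := dφ.exp
  have e2 := (dφ.const_mul (-2)).exp
  have c1 := dψ.cos
  have s1 := dψ.sin
  have c2 := (dψ.const_mul 2).cos
  have s2 := (dψ.const_mul 2).sin
  have k1 : ∀ u, fderiv ℝ (fun y => Real.exp (φ y) * Real.cos (ψ y)) S.y₀ u =
      Real.exp (φ S.y₀) * (Real.cos (ψ S.y₀) * fderiv ℝ φ S.y₀ u -
        Real.sin (ψ S.y₀) * fderiv ℝ ψ S.y₀ u) := fun u => by
    rw [(e1.fun_mul c1).fderiv]; simp; ring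
  have k2 : ∀ u, fderiv ℝ (fun y => Real.exp (φ y) * Real.sin (ψ y)) S.y₀ u =
      Real.exp (φ S.y₀) * (Real.sin (ψ S.y₀) * fderiv ℝ φ S.y₀ u +
        Real.cos (ψ S.y₀) * fderiv ℝ ψ S.y₀ u) := fun u => by
    rw [(e1.fun_mul s1).fderiv]; simp; ring
  have k3 : ∀ u, fderiv ℝ (fun y => Real.exp (-2 * φ y) * Real.sin (2 * ψ y)) S.y₀ u =
      Real.exp (-2 * φ S.y₀) * (-2 * fderiv ℝ φ S.y₀ u * Real.sin (2 * ψ S.y₀) +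
        2 * fderiv ℝ ψ S.y₀ u * Real.cos (2 * ψ S.y₀)) := fun u => by
    rw [(e2.fun_mul s2).fderiv]; simp; ring
  have k4 : ∀ u, fderiv ℝ (fun y => Real.exp (-2 * φ y) * Real.cos (2 * ψ y)) S.y₀ u =
      Real.exp (-2 * φ S.y₀) * (-2 * fderiv ℝ φ S.y₀ u * Real.cos (2 * ψ S.y₀) -
        2 * fderiv ℝ ψ S.y₀ u * Real.sin (2 * ψ S.y₀)) := fun u => by
    rw [(e2.fun_mul c2).fderiv]; simp; ring
  have k5 : ∀ u, fderiv ℝ (fun y => -(Real.exp (-2 * φ y) * Real.cos (2 * ψ y))) S.y₀ u =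
      Real.exp (-2 * φ S.y₀) * (2 * fderiv ℝ φ S.y₀ u * Real.cos (2 * ψ S.y₀) +
        2 * fderiv ℝ ψ S.y₀ u * Real.sin (2 * ψ S.y₀)) := fun u => by
    rw [(e2.fun_mul c2).fun_neg.fderiv]; simp; ring
  have k6 : ∀ (r : ℝ) (u : E4), fderiv ℝ (fun _ : E4 => r) S.y₀ u = 0 := fun r u => by simp
  have hexp : ContDiffAt ℝ ∞ (fun y => Real.exp (φ y)) S.y₀ := hφ.exp
  rw [killing_comb hs hU hb (hexp.mul hψ.cos) (hexp.mul hψ.sin),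
    hodge3_extDeriv_comb hs hU hb (e2.fun_mul s2).differentiableAt
      (e2.fun_mul c2).differentiableAt,
    hodge3_extDeriv_comb hs hU hb (e2.fun_mul c2).fun_neg.differentiableAt
      (e2.fun_mul s2).differentiableAt,
    hodge3_extDeriv_comb hs hU hb (differentiableAt_const _) (differentiableAt_const _),
    umbilical_iff hs hU hb]
  simp only [k1, k2, k3, k4, k5, k6]
  have := killing_iff (c := Real.cos (ψ S.y₀)) (s := Real.sin (ψ S.y₀)) (E := Real.exp (φ S.y₀))
    (K := Real.exp (-2 * φ S.y₀)) (Real.cos_sq_add_sin_sq _) (Real.exp_pos _).ne'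
    (Real.exp_pos _).ne' (fun i => fderiv ℝ φ S.y₀ (b i)) (fun i => fderiv ℝ ψ S.y₀ (b i))
    (fun i => S.cov U (b i) (b 0) (b 2)) (fun i => S.cov U (b i) (b 0) (b 3))
    (fun i => S.cov U (b i) (b 1) (b 2)) (fun i => S.cov U (b i) (b 1) (b 3))
  -- The algebraic statement has 2sc and c² - s² in place of the sine and cosine of 2ψ.
  rw [← Real.sin_two_mul, ← Real.cos_two_mul'] at this
  exact this

end LocalSpacetime
/-! ## From the manifold to the charts -/

section Charts

variable {M : Type*} [TopologicalSpace M] [ChartedSpace E4 M]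

/-- The differential of the chart at `p`, at the point with coordinates `y`. -/
def chartDeriv (p : M) (y : E4) : E4 →L[ℝ] E4 :=
  mfderiv (𝓡 4) 𝓘(ℝ, E4) (extChartAt (𝓡 4) p) ((extChartAt (𝓡 4) p).symm y)

/-- The differential of the inverse chart, as an endomorphism of `ℝ⁴`. -/
def chartInv (p : M) (y : E4) : E4 →L[ℝ] E4 := invChartDeriv p y

lemma target_mem_nhds (p : M) :
    (extChartAt (𝓡 4) p).target ∈ nhds (extChartAt (𝓡 4) p p) :=
  extChartAt_target_mem_nhds p

lemma inChart_apply {k : ℕ} (α : FormField M k) (p : M) (y : E4) (v : Fin k → E4) :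
    FormField.inChart α p y v =
      (α ((extChartAt (𝓡 4) p).symm y) : E4 [⋀^Fin k]→L[ℝ] ℝ) (fun i => chartInv p y (v i)) := rfl

lemma inChart_apply₂ (α : FormField M 2) (p : M) (y v w : E4) :
    FormField.inChart α p y ![v, w] =
      (α ((extChartAt (𝓡 4) p).symm y) : E4 [⋀^Fin 2]→L[ℝ] ℝ)
        ![chartInv p y v, chartInv p y w] := by
  rw [inChart_apply]
  congr 1; ext i : 1; fin_cases i <;> rfl

lemma bilin_inChart_apply (g : BilinField M) (p : M) (y v w : E4) :
    BilinField.inChart g p y v w =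
      (g ((extChartAt (𝓡 4) p).symm y) : Bilin4) (chartInv p y v) (chartInv p y w) := rfl

variable [IsManifold (𝓡 4) ∞ M]

lemma chartDeriv_chartInv (p : M) {y : E4} (hy : y ∈ (extChartAt (𝓡 4) p).target) (x : E4) :
    chartDeriv p y (chartInv p y x) = x := by
  have : IsManifold (𝓡 4) 1 M := IsManifold.of_le (n := ∞) (by norm_cast)
  have h := mfderiv_extChartAt_comp_mfderivWithin_extChartAt_symm (I := 𝓡 4) hy
  rw [ModelWithCorners.range_eq_univ, mfderivWithin_univ] at h
  exact DFunLike.congr_fun h x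

lemma chartInv_chartDeriv (p : M) {y : E4} (hy : y ∈ (extChartAt (𝓡 4) p).target) (x : E4) :
    chartInv p y (chartDeriv p y x) = x := by
  have : IsManifold (𝓡 4) 1 M := IsManifold.of_le (n := ∞) (by norm_cast)
  have h := mfderivWithin_extChartAt_symm_comp_mfderiv_extChartAt (I := 𝓡 4) hy
  rw [ModelWithCorners.range_eq_univ, mfderivWithin_univ] at h
  exact DFunLike.congr_fun h x

lemma chartInv_surjective (p : M) {y : E4} (hy : y ∈ (extChartAt (𝓡 4) p).target) :
    Function.Surjective (chartInv p y) := fun x => ⟨_, chartInv_chartDeriv p hy x⟩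

lemma chartInv_self (p : M) (x : E4) : chartInv p (extChartAt (𝓡 4) p p) x = x := by
  have : IsManifold (𝓡 4) 1 M := IsManifold.of_le (n := ∞) (by norm_cast)
  have h := mfderivWithin_range_extChartAt_symm (I := 𝓡 4) (x := p)
  rw [ModelWithCorners.range_eq_univ, mfderivWithin_univ] at h
  exact DFunLike.congr_fun h x

lemma chartDeriv_self (p : M) (x : E4) : chartDeriv p (extChartAt (𝓡 4) p p) x = x := by
  conv_lhs => rw [← chartInv_self p x]
  exact chartDeriv_chartInv p (mem_extChartAt_target p) x

lemma inChart_self {k : ℕ} (α : FormField M k) (p : M) :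
    FormField.inChart α p (extChartAt (𝓡 4) p p) = (α p : E4 [⋀^Fin k]→L[ℝ] ℝ) := by
  ext v
  rw [inChart_apply]
  simp only [chartInv_self]
  exact congrArg (fun q => (α q : E4 [⋀^Fin k]→L[ℝ] ℝ) v) (extChartAt_to_inv p)

lemma bilin_inChart_self (g : BilinField M) (p : M) :
    BilinField.inChart g p (extChartAt (𝓡 4) p p) = (g p : Bilin4) := by
  ext v w
  rw [bilin_inChart_apply, chartInv_self, chartInv_self]
  exact congrArg (fun q => (g q : Bilin4) v w) (extChartAt_to_inv p)

lemma vec_inChart_self (X : VecField M) (p : M) :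
    VecField.inChart X p (extChartAt (𝓡 4) p p) = (X p : E4) := by
  refine (chartDeriv_self p _).trans ?_
  exact congrArg (fun q => (X q : E4)) (extChartAt_to_inv p)

end Charts

namespace OrientedSpacetime

variable {M : Type*} [TopologicalSpace M] [ChartedSpace E4 M] [IsManifold (𝓡 4) ∞ M]
  (S : OrientedSpacetime M)

omit [IsManifold (𝓡 4) ∞ M] in
lemma exists_isFrame (p : M) : ∃ b : Fin 4 → E4, IsFrame (S.metric p : Bilin4) b := by
  obtain ⟨b, hb⟩ := S.signature p
  exact ⟨b, hb⟩

/-- The expression of a spacetime in the chart at `p`. -/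
def chart (p : M) : LocalSpacetime where
  G := BilinField.inChart S.metric p
  η := FormField.inChart S.vol p
  y₀ := extChartAt (𝓡 4) p p
  symm := fun y u v => S.symm _ _ _
  frame := by
    -- The inverse chart is controlled only on the chart's target, so frames are obtained only near
    -- the point.
    filter_upwards [target_mem_nhds p] with y hy
    obtain ⟨b, hb⟩ := S.exists_isFrame ((extChartAt (𝓡 4) p).symm y)
    exact LocalSpacetime.IsFrame.comp hb (chartInv_surjective p hy) (bilin_inChart_apply _ p y)
  vol_sq := fun y v => S.vol_sq _ _
  smooth_G := (S.smooth_metric p).contDiffAt (target_mem_nhds p)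
  smooth_η := (S.smooth_vol p).contDiffAt (target_mem_nhds p)

lemma chart_G (p : M) : (S.chart p).G (S.chart p).y₀ = (S.metric p : Bilin4) :=
  bilin_inChart_self S.metric p

lemma chart_η (p : M) : (S.chart p).η (S.chart p).y₀ = (S.vol p : E4 [⋀^Fin 4]→L[ℝ] ℝ) :=
  inChart_self S.vol p

lemma inChart_star (α : FormField M 2) (p : M) {y : E4}
    (hy : y ∈ (extChartAt (𝓡 4) p).target) :
    FormField.inChart (S.star α) p y = (S.chart p).star (FormField.inChart α p) y := by
  obtain ⟨b, hb⟩ := S.exists_isFrame ((extChartAt (𝓡 4) p).symm y)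
  exact (hodge2_comp hb (S.symm _) _ _ _ (chartInv_surjective p hy)
    (bilin_inChart_apply _ p y)).symm

lemma christoffel_eq (p : M) (u v : E4) : S.christoffel p u v = (S.chart p).Γ u v := by
  rw [christoffel, LocalSpacetime.Γ, chart_G]
  rfl

lemma covDeriv_eq (α : FormField M 2) (p : M) (u v w : E4) :
    S.covDeriv α p u v w = (S.chart p).cov (FormField.inChart α p) u v w := by
  have h : FormField.inChart α p (S.chart p).y₀ = (α p : E4 [⋀^Fin 2]→L[ℝ] ℝ) := inChart_self α p
  rw [LocalSpacetime.cov, h, ← christoffel_eq, ← christoffel_eq]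
  rfl

lemma covDerivVec_eq (X : VecField M) (p : M) (u : E4) :
    S.covDerivVec X p u = (S.chart p).covVec (VecField.inChart X p) u := by
  have h : VecField.inChart X p (S.chart p).y₀ = (X p : E4) := vec_inChart_self X p
  have hΓ : S.christoffel p u (X p) = (S.chart p).Γ u (VecField.inChart X p (S.chart p).y₀) :=
    (S.christoffel_eq p u (X p)).trans (congrArg ((S.chart p).Γ u) h.symm)
  exact congrArg (fun x : E4 => fderiv ℝ (VecField.inChart X p) (S.chart p).y₀ u + x) hΓ

lemma codiff_eq (α : FormField M 2) (p : M) : S.codiff α p =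
    hodge3 ((S.chart p).G (S.chart p).y₀) ((S.chart p).η (S.chart p).y₀)
      (extDeriv (FormField.inChart (S.star α) p) (S.chart p).y₀) := by
  rw [chart_G, chart_η]
  rfl

variable {S} {U : FormField M 2}

lemma smooth_inChart (hU : FormField.IsSmooth U) (p : M) :
    ContDiffAt ℝ ∞ (FormField.inChart U p) (S.chart p).y₀ :=
  (hU p).contDiffAt (target_mem_nhds p)

omit [IsManifold (𝓡 4) ∞ M] in
lemma isUnitary (hU : S.IsCanonicalForm U) (p : M) :
    IsUnitary (S.metric p : Bilin4) (U p : E4 [⋀^Fin 2]→L[ℝ] ℝ) := hU.2 p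

lemma isUnitary_chart (hU : S.IsCanonicalForm U) (p : M) :
    ∀ᶠ y in nhds (S.chart p).y₀, IsUnitary ((S.chart p).G y) (FormField.inChart U p y) := by
  filter_upwards [target_mem_nhds p] with y hy
  exact LocalSpacetime.IsUnitary.comp (isUnitary hU _) (chartInv_surjective p hy)
    (bilin_inChart_apply _ p y) (inChart_apply₂ U p y)

omit [IsManifold (𝓡 4) ∞ M] in
lemma exists_adapted (hU : S.IsCanonicalForm U) (p : M) : ∃ b : Fin 4 → E4,
    IsAdapted (S.metric p : Bilin4) (S.vol p : E4 [⋀^Fin 4]→L[ℝ] ℝ)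
      (U p : E4 [⋀^Fin 2]→L[ℝ] ℝ) b := by
  obtain ⟨b, hb⟩ := S.exists_isFrame p
  exact exists_isAdapted hb (S.symm p) (S.vol_sq p) (isUnitary hU p)

/-- Local vector fields tangent to `ker β` extend. -/
lemma exists_extension (β : FormField M 2) (p : M) (X : E4 → E4)
    (hX : ∀ᶠ y in nhds (extChartAt (𝓡 4) p p), X y ∈ formKer (FormField.inChart β p y)) :
    ∃ Y : VecField M, (∀ q, Y q ∈ formKer (β q : E4 [⋀^Fin 2]→L[ℝ] ℝ)) ∧
      VecField.inChart Y p =ᶠ[nhds (extChartAt (𝓡 4) p p)] X := by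
  classical
  -- Tangency is required everywhere but smoothness only at `p`, so `X` is extended by zero, without
  -- a cutoff, wherever it is undefined or fails to be tangent.
  let Y : M → E4 := fun q =>
    if q ∈ (extChartAt (𝓡 4) p).source ∧
      X (extChartAt (𝓡 4) p q) ∈ formKer (FormField.inChart β p (extChartAt (𝓡 4) p q)) then
    chartInv p (extChartAt (𝓡 4) p q) (X (extChartAt (𝓡 4) p q)) else 0
  refine ⟨Y, fun q => ?_, ?_⟩
  · by_cases hq : q ∈ (extChartAt (𝓡 4) p).source ∧
      X (extChartAt (𝓡 4) p q) ∈ formKer (FormField.inChart β p (extChartAt (𝓡 4) p q))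
    · have hY : Y q = chartInv p (extChartAt (𝓡 4) p q) (X (extChartAt (𝓡 4) p q)) := if_pos hq
      rw [hY]
      intro w
      obtain ⟨w, rfl⟩ := chartInv_surjective p ((extChartAt (𝓡 4) p).map_source hq.1) w
      have h := hq.2 w
      rw [inChart_apply₂] at h
      rw [← h]
      exact congrArg (fun q' => (β q' : E4 [⋀^Fin 2]→L[ℝ] ℝ)
        ![chartInv p (extChartAt (𝓡 4) p q) (X (extChartAt (𝓡 4) p q)),
          chartInv p (extChartAt (𝓡 4) p q) w]) ((extChartAt (𝓡 4) p).left_inv hq.1).symm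
    · have hY : Y q = 0 := if_neg hq
      rw [hY]
      intro w
      have := alt_cons_smul (β q : E4 [⋀^Fin 2]→L[ℝ] ℝ) 0 0 ![w]
      rwa [zero_smul, zero_mul] at this
  · filter_upwards [hX, target_mem_nhds p] with y hy hyt
    have hs := (extChartAt (𝓡 4) p).map_target hyt
    have hr := (extChartAt (𝓡 4) p).right_inv hyt
    have hY : Y ((extChartAt (𝓡 4) p).symm y) = chartInv p y (X y) := by
      have h : Y ((extChartAt (𝓡 4) p).symm y) =
          chartInv p (extChartAt (𝓡 4) p ((extChartAt (𝓡 4) p).symm y))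
            (X (extChartAt (𝓡 4) p ((extChartAt (𝓡 4) p).symm y))) :=
        if_pos ⟨hs, by rw [hr]; exact hy⟩
      rw [h, hr]
    exact (congrArg (chartDeriv p y) hY).trans (chartDeriv_chartInv p hyt _)

lemma covVec_congr {p : M} {X Y : E4 → E4} (h : X =ᶠ[nhds (S.chart p).y₀] Y) (u : E4) :
    (S.chart p).covVec X u = (S.chart p).covVec Y u := by
  rw [LocalSpacetime.covVec, LocalSpacetime.covVec, h.fderiv_eq, h.eq_of_nhds]

/-- Replaces all ingredients of the umbilicity equation at once, avoiding rewriting inside terms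
whose types depend on the point. -/
lemma umbilical_congr {g g' : Bilin4} {x x' y y' a a' b b' : E4} (hg : g = g') (hx : x = x')
    (hy : y = y') (ha : a = a') (hb : b = b') (n z : E4)
    (h : (1 / 2 : ℝ) * g (a + b) z = g x y * g n z) :
    (1 / 2 : ℝ) * g' (a' + b') z = g' x' y' * g' n z := by
  subst hg hx hy ha hb
  exact h

lemma isUmbilicalPlaneField_iff (β : FormField M 2) :
    S.IsUmbilicalPlaneField (fun p => formKer (β p : E4 [⋀^Fin 2]→L[ℝ] ℝ)) ↔
      ∀ p, (S.chart p).IsUmbilicalAt (fun y => formKer (FormField.inChart β p y)) := by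
  refine forall_congr' fun p => exists_congr fun n => ?_
  have hβ : formKer (FormField.inChart β p (S.chart p).y₀) =
    formKer (β p : E4 [⋀^Fin 2]→L[ℝ] ℝ) := congrArg formKer (inChart_self β p)
  have hG := S.chart_G p
  constructor
  · intro h X Y hX hY hXD hYD z hz
    obtain ⟨X', hX', eX⟩ := exists_extension β p X hXD
    obtain ⟨Y', hY', eY⟩ := exists_extension β p Y hYD
    have hz' : ∀ w ∈ formKer (β p : E4 [⋀^Fin 2]→L[ℝ] ℝ), (S.metric p : Bilin4) z w = 0 := by
      intro w hw
      rw [← hG]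
      have hw' : w ∈ formKer (FormField.inChart β p (S.chart p).y₀) := by rw [hβ]; exact hw
      exact hz w hw'
    have e1 : X' p = X (S.chart p).y₀ := (vec_inChart_self X' p).symm.trans eX.eq_of_nhds
    have e2 : Y' p = Y (S.chart p).y₀ := (vec_inChart_self Y' p).symm.trans eY.eq_of_nhds
    exact umbilical_congr hG.symm e1 e2
      ((S.covDerivVec_eq Y' p _).trans ((covVec_congr eY _).trans (congrArg _ e1)))
      ((S.covDerivVec_eq X' p _).trans ((covVec_congr eX _).trans (congrArg _ e2))) n z
      (h X' Y' (hX.congr_of_eventuallyEq eX) (hY.congr_of_eventuallyEq eY) hX' hY' z hz')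
  · intro h X Y hX hY hXD hYD z hz
    have hmem : ∀ X : VecField M, (∀ q, X q ∈ formKer (β q : E4 [⋀^Fin 2]→L[ℝ] ℝ)) →
        ∀ᶠ y in nhds (S.chart p).y₀, VecField.inChart X p y ∈ formKer (FormField.inChart β p y) := by
      intro X hX
      filter_upwards [target_mem_nhds p] with y hy
      intro w
      have hx : chartInv p y (VecField.inChart X p y) = X ((extChartAt (𝓡 4) p).symm y) :=
        chartInv_chartDeriv p hy _
      rw [inChart_apply₂, hx]
      exact hX _ _
    have hz' : ∀ w ∈ formKer (FormField.inChart β p (S.chart p).y₀),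
        (S.chart p).G (S.chart p).y₀ z w = 0 := by
      intro w hw
      rw [hG]
      rw [hβ] at hw
      exact hz w hw
    have e1 : VecField.inChart X p (S.chart p).y₀ = X p := vec_inChart_self X p
    have e2 : VecField.inChart Y p (S.chart p).y₀ = Y p := vec_inChart_self Y p
    exact umbilical_congr hG e1 e2
      ((congrArg _ e1).trans (S.covDerivVec_eq Y p _).symm)
      ((congrArg _ e2).trans (S.covDerivVec_eq X p _).symm) n z
      (h (VecField.inChart X p) (VecField.inChart Y p) hX hY (hmem X hXD) (hmem Y hYD) z hz')

end OrientedSpacetime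
-- Linearity and involutivity of the Hodge dual, and the passage to the global statement.
section Linear

variable (g : Bilin4) (η : E4 [⋀^Fin 4]→L[ℝ] ℝ)

lemma hodge2_add (α β : E4 [⋀^Fin 2]→L[ℝ] ℝ) :
    hodge2 g η (α + β) = hodge2 g η α + hodge2 g η β := by
  simp only [hodge2, ContinuousAlternatingMap.add_apply, add_smul, Finset.sum_add_distrib, smul_add]

lemma hodge2_smul (c : ℝ) (α : E4 [⋀^Fin 2]→L[ℝ] ℝ) : hodge2 g η (c • α) = c • hodge2 g η α := by
  simp only [hodge2, ContinuousAlternatingMap.smul_apply, smul_assoc, ← Finset.smul_sum]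
  rw [smul_comm]

lemma hodge3_add (α β : E4 [⋀^Fin 3]→L[ℝ] ℝ) :
    hodge3 g η (α + β) = hodge3 g η α + hodge3 g η β := by
  simp only [hodge3, ContinuousAlternatingMap.add_apply, add_smul, Finset.sum_add_distrib, smul_add]

lemma hodge3_smul (c : ℝ) (α : E4 [⋀^Fin 3]→L[ℝ] ℝ) : hodge3 g η (c • α) = c • hodge3 g η α := by
  simp only [hodge3, ContinuousAlternatingMap.smul_apply, smul_assoc, ← Finset.smul_sum]
  rw [smul_comm]

variable {g η}

lemma alt_frame_ext {b : Fin 4 → E4} (hb : IsFrame g b) {α β : E4 [⋀^Fin 2]→L[ℝ] ℝ}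
    (h : ∀ k l, α ![b k, b l] = β ![b k, b l]) : α = β := by
  refine alt2_ext fun v w => ?_
  rw [hb.expand v, hb.expand w]
  simp only [alt_cons_sum, alt_cons_smul, alt_cons_cons_sum, alt_cons_cons_smul, h]

/-- In signature (-+++) the dual is a complex structure on 2-forms. Hence it sends the coefficients
(P, Q) of U and *U to (-Q, P). -/
lemma IsOriented.hodge2_hodge2 {b : Fin 4 → E4} (hb : IsOriented g η b)
    (α : E4 [⋀^Fin 2]→L[ℝ] ℝ) : hodge2 g η (hodge2 g η α) = -α := by
  have anti : ∀ (β : E4 [⋀^Fin 2]→L[ℝ] ℝ) (k l : Fin 4), β ![b k, b l] = -β ![b l, b k] :=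
    fun β k l => alt_swap β _ _ _
  have diag : ∀ (β : E4 [⋀^Fin 2]→L[ℝ] ℝ) (k : Fin 4), β ![b k, b k] = 0 := fun β k => by
    linarith [anti β k k]
  have d01 := fun γ => (hb.hodge2_apply γ 0 1).trans (dual_01 (anti γ))
  have d02 := fun γ => (hb.hodge2_apply γ 0 2).trans (dual_02 (anti γ))
  have d03 := fun γ => (hb.hodge2_apply γ 0 3).trans (dual_03 (anti γ))
  have d12 := fun γ => (hb.hodge2_apply γ 1 2).trans (dual_12 (anti γ))
  have d13 := fun γ => (hb.hodge2_apply γ 1 3).trans (dual_13 (anti γ))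
  have d23 := fun γ => (hb.hodge2_apply γ 2 3).trans (dual_23 (anti γ))
  have h : ∀ k l, k < l → hodge2 g η (hodge2 g η α) ![b k, b l] = -α ![b k, b l] := by
    intro k l hkl
    fin_cases k <;> fin_cases l <;> first | exact absurd hkl (by decide) | skip
    · exact (d01 _).trans (d23 _)
    · exact (d02 _).trans (congrArg Neg.neg (d13 _))
    · exact (d03 _).trans (d12 _)
    · exact (d12 _).trans (congrArg Neg.neg (d03 _))
    · exact (d13 _).trans (d02 _)
    · exact (d23 _).trans (congrArg Neg.neg (d01 _))
  refine alt_frame_ext hb.frame fun k l => ?_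
  rw [ContinuousAlternatingMap.neg_apply]
  rcases lt_trichotomy k l with hkl | rfl | hkl
  · exact h k l hkl
  · rw [diag, diag, neg_zero]
  · rw [anti, h l k hkl]
    exact congrArg Neg.neg (anti α k l).symm

lemma IsOriented.hodge2_combination {b : Fin 4 → E4} (hb : IsOriented g η b) (x y : ℝ)
    (α : E4 [⋀^Fin 2]→L[ℝ] ℝ) :
    hodge2 g η (x • α + y • hodge2 g η α) = -y • α + x • hodge2 g η α := by
  rw [hodge2_add, hodge2_smul, hodge2_smul, hb.hodge2_hodge2]
  module

end Linear

namespace LocalSpacetime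

variable {S : LocalSpacetime}

lemma cov_congr {α β : E4 → E4 [⋀^Fin 2]→L[ℝ] ℝ} (h : α =ᶠ[nhds S.y₀] β) (u v w : E4) :
    S.cov α u v w = S.cov β u v w := by
  rw [cov, cov, h.fderiv_eq, h.eq_of_nhds]

lemma isUmbilicalAt_congr {D D' : E4 → Set E4} (h : D =ᶠ[nhds S.y₀] D') :
    S.IsUmbilicalAt D ↔ S.IsUmbilicalAt D' := by
  have key : ∀ X : E4 → E4, (∀ᶠ y in nhds S.y₀, X y ∈ D y) ↔ ∀ᶠ y in nhds S.y₀, X y ∈ D' y :=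
    fun X => Filter.eventually_congr (h.mono fun y hy => by rw [hy])
  simp only [IsUmbilicalAt, key, h.eq_of_nhds]

lemma hodge3_extDeriv_comb_const {U : E4 → E4 [⋀^Fin 2]→L[ℝ] ℝ} (hs : ContDiffAt ℝ ∞ U S.y₀)
    (g : Bilin4) (η : E4 [⋀^Fin 4]→L[ℝ] ℝ) (a c : ℝ) :
    hodge3 g η (extDeriv (S.comb U (fun _ => a) (fun _ => c)) S.y₀) =
      a • hodge3 g η (extDeriv U S.y₀) + c • hodge3 g η (extDeriv (S.star U) S.y₀) := by
  have h1 : DifferentiableAt ℝ U S.y₀ := hs.differentiableAt (by simp)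
  have h2 : DifferentiableAt ℝ (S.star U) S.y₀ := (S.smooth_star hs).differentiableAt (by simp)
  have e : extDeriv (S.comb U (fun _ => a) (fun _ => c)) S.y₀ =
      a • extDeriv U S.y₀ + c • extDeriv (S.star U) S.y₀ := by
    rw [← extDeriv_fun_smul a, ← extDeriv_fun_smul c]
    exact extDeriv_fun_add (h1.const_smul a) (h2.const_smul c)
  rw [e, hodge3_add, hodge3_smul, hodge3_smul]

end LocalSpacetime

namespace OrientedSpacetime

variable {M : Type*} [TopologicalSpace M] [ChartedSpace E4 M] [IsManifold (𝓡 4) ∞ M]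
  {S : OrientedSpacetime M} {U : FormField M 2}

/-- The 2-form `P U + Q *U`. -/
def comb (S : OrientedSpacetime M) (U : FormField M 2) (P Q : M → ℝ) : FormField M 2 :=
  fun p => P p • U p + Q p • S.star U p

lemma inChart_comb (P Q : M → ℝ) (p : M) :
    FormField.inChart (S.comb U P Q) p =ᶠ[nhds (S.chart p).y₀]
      (S.chart p).comb (FormField.inChart U p) (fun y => P ((extChartAt (𝓡 4) p).symm y))
        (fun y => Q ((extChartAt (𝓡 4) p).symm y)) := by
  filter_upwards [target_mem_nhds p] with y hy
  rw [LocalSpacetime.comb, ← inChart_star S U p hy]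
  rfl

omit [IsManifold (𝓡 4) ∞ M] in
lemma star_comb (hU : S.IsCanonicalForm U) (P Q : M → ℝ) :
    S.star (S.comb U P Q) = S.comb U (fun p => -Q p) P := by
  funext p
  obtain ⟨b, hb⟩ := exists_adapted hU p
  exact hb.hodge2_combination _ _ _

/-- Since δ = *d* and ** = -1, the codifferential is the dual of the exterior derivative of another
combination of U and *U, to which the chart computation applies. -/
lemma codiff_comb (hU : S.IsCanonicalForm U) (P Q : M → ℝ) (p : M) :
    S.codiff (S.comb U P Q) p = hodge3 ((S.chart p).G (S.chart p).y₀) ((S.chart p).η (S.chart p).y₀)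
      (extDeriv ((S.chart p).comb (FormField.inChart U p)
        (fun y => -Q ((extChartAt (𝓡 4) p).symm y))
        (fun y => P ((extChartAt (𝓡 4) p).symm y))) (S.chart p).y₀) := by
  rw [codiff_eq, star_comb hU]
  exact congrArg _ (inChart_comb _ _ p).extDeriv_eq

lemma isUmbilicalStructure_iff (hU : S.IsCanonicalForm U) : S.IsUmbilicalStructure U ↔
    ∀ p, (S.chart p).IsUmbilicalAt
        (fun y => formKer ((S.chart p).star (FormField.inChart U p) y)) ∧
      (S.chart p).IsUmbilicalAt (fun y => formKer (FormField.inChart U p y)) := by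
  -- V, the orthogonal complement of ker U, is ker *U, so both planes are kernels of 2-forms.
  have ht : S.timePlane U = fun p => formKer (S.star U p : E4 [⋀^Fin 2]→L[ℝ] ℝ) := by
    funext p
    obtain ⟨b, hb⟩ := exists_adapted hU p
    exact Set.ext fun x => (hb.mem_formKer_star_iff x).symm
  rw [forall_and, IsUmbilicalStructure, ht]
  refine and_congr ((isUmbilicalPlaneField_iff (S.star U)).trans (forall_congr' fun p => ?_))
    (isUmbilicalPlaneField_iff U)
  refine LocalSpacetime.isUmbilicalAt_congr ?_
  filter_upwards [target_mem_nhds p] with y hy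
  rw [inChart_star S U p hy]

lemma smooth_comp_symm {f : M → ℝ} (hf : ContMDiff (𝓡 4) 𝓘(ℝ, ℝ) ∞ f) (p : M) :
    ContDiffAt ℝ ∞ (fun y => f ((extChartAt (𝓡 4) p).symm y)) (S.chart p).y₀ :=
  (hf.comp_contMDiffOn (contMDiffOn_extChartAt_symm p)).contDiffOn.contDiffAt (target_mem_nhds p)

end OrientedSpacetime
end Spacetime
end

open Spacetime OrientedSpacetime in
theorem mainTheorem7 {M : Type*} [TopologicalSpace M]
    [ChartedSpace (EuclideanSpace ℝ (Fin 4)) M] [IsManifold (𝓡 4) ∞ M]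
    (S : Spacetime.OrientedSpacetime M) (U : Spacetime.FormField M 2) (hU : S.IsCanonicalForm U)
    (φ ψ : M → ℝ) (hφ : ContMDiff (𝓡 4) 𝓘(ℝ, ℝ) ∞ φ) (hψ : ContMDiff (𝓡 4) 𝓘(ℝ, ℝ) ∞ ψ) :
    S.IsKillingYano
        (fun p => Real.exp (φ p) • (Real.cos (ψ p) • U p + Real.sin (ψ p) • S.star U p)) ↔
      S.IsMaxwell (fun p => Real.exp (-2 * φ p) •
          (Real.cos (2 * ψ p) • U p - Real.sin (2 * ψ p) • S.star U p)) ∧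
        S.IsUmbilicalStructure U ∧
        ∀ p, Real.cos (ψ p) • S.codiff U p + Real.sin (ψ p) • S.codiff (S.star U) p = 0 := by
  have hA : (fun p => Real.exp (φ p) • (Real.cos (ψ p) • U p + Real.sin (ψ p) • S.star U p)) =
      S.comb U (fun p => Real.exp (φ p) * Real.cos (ψ p))
        (fun p => Real.exp (φ p) * Real.sin (ψ p)) := by
    funext p
    rw [smul_add, smul_smul, smul_smul]
    rfl
  have hF : (fun p => Real.exp (-2 * φ p) •
        (Real.cos (2 * ψ p) • U p - Real.sin (2 * ψ p) • S.star U p)) =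
      S.comb U (fun p => Real.exp (-2 * φ p) * Real.cos (2 * ψ p))
        (fun p => -(Real.exp (-2 * φ p) * Real.sin (2 * ψ p))) := by
    have h : ∀ (r c s : ℝ) (x y : E4 [⋀^Fin 2]→L[ℝ] ℝ),
        r • (c • x - s • y) = (r * c) • x + (-(r * s)) • y := by
      intro r c s x y
      module
    exact funext fun p => h _ _ _ _ _
  -- U and *U are written as combinations with constant coefficients so that `codiff_comb` covers δU
  -- and δ*U as well.
  have hU' : S.codiff U = S.codiff (S.comb U (fun _ => 1) (fun _ => 0)) := by
    congr 1
    funext p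
    exact (by rw [one_smul, zero_smul, add_zero] :
      U p = (1 : ℝ) • U p + (0 : ℝ) • S.star U p)
  have hW' : S.codiff (S.star U) = S.codiff (S.comb U (fun _ => 0) (fun _ => 1)) := by
    congr 1
    funext p
    exact (by rw [one_smul, zero_smul, zero_add] :
      S.star U p = (0 : ℝ) • U p + (1 : ℝ) • S.star U p)
  rw [hA, hF, isUmbilicalStructure_iff hU, IsMaxwell, star_comb hU, hU', hW']
  simp only [← forall_and, IsKillingYano]
  refine forall_congr' fun p => ?_
  have hp : (extChartAt (𝓡 4) p).symm (S.chart p).y₀ = p := extChartAt_to_inv p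
  have key := LocalSpacetime.killing_iff_maxwell (smooth_inChart hU.1 p) (isUnitary_chart hU p)
    (smooth_comp_symm hφ p) (smooth_comp_symm hψ p)
  rw [LocalSpacetime.hodge3_extDeriv_comb_const (smooth_inChart hU.1 p), hp] at key
  simp only [codiff_comb hU, neg_neg, neg_zero]
  rw [LocalSpacetime.hodge3_extDeriv_comb_const (smooth_inChart hU.1 p),
    LocalSpacetime.hodge3_extDeriv_comb_const (smooth_inChart hU.1 p)]
  -- With x = *dU and y = *d*U one has δU = y and δ*U = -x, so the extra condition is closedness of
  -- -sin ψ U + cos ψ *U with ψ frozen at its value at `p`.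
  have hc : ∀ (c s : ℝ) (x y : E4 [⋀^Fin 1]→L[ℝ] ℝ),
      c • ((0 : ℝ) • x + (1 : ℝ) • y) + s • ((-1 : ℝ) • x + (0 : ℝ) • y) = -s • x + c • y := by
    intro c s x y
    module
  have hk : ∀ u v w : E4, S.covDeriv (S.comb U (fun p => Real.exp (φ p) * Real.cos (ψ p))
        (fun p => Real.exp (φ p) * Real.sin (ψ p))) p u v w = _ := fun u v w =>
    (S.covDeriv_eq _ p u v w).trans
      (LocalSpacetime.cov_congr (inChart_comb _ _ p) u v w)
  refine Iff.trans (forall_congr' fun u => forall_congr' fun v => forall_congr' fun w => ?_)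
    (key.trans (and_congr_right fun _ => and_congr_right fun _ => ?_))
  · exact (congrArg₂ (fun x y : ℝ => x + y = 0) (hk u v w) (hk v u w)).to_iff
  · exact (congrArg (· = 0) (hc _ _ _ _).symm).to_iff
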